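/- Let $k$ be a field. A commutative formal group over $k$ of dimension $n\ge 0$ is an $n$-tuple $F(X,Y)$ of formal power series over $k$ without constant terms, in two sets of $n$ variables $X=(X_1,\dots,X_n)$, $Y=(Y_1,\dots,Y_n)$, such that $F(X,0)=X$, $F(F(X,Y),Z)=F(X,F(Y,Z))$ and $F(X,Y)=F(Y,X)$. A homomorphism $F\to G$ is a tuple $f(X)$ of $\dim G$ power series over $k$ in $\dim F$ variables, without constant terms, such that $f(F(X,Y))=G(f(X),f(Y))$; composition is substitution. Let $\mathcal{FG}_k$ be the full subcategory of the category of commutative formal groups over $k$ whose objects are the finite products of one-dimensional formal groups, and let $K_0(\mathcal{FG}_k)$ be its Grothendieck group, that is, the group completion of the commutative monoid of isomorphism classes of objects of $\mathcal{FG}_k$ under the product. Then $K_0(\mathcal{FG}_k)$ is a free abelian group and, if $k$ has positive characteristic, it is free on an infinite set of generators (a $\mathbb{Z}$-basis is infinite). -/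

import Mathlib

universe u v

noncomputable section

open CategoryTheory CategoryTheory.Limits

/-! ### Tuples of power series -/

namespace PowerSeriesTuple

open MvPowerSeries

variable {R : Type u} [CommRing R] {m n σ τ : Type}

/-- Substitute the tuple `a` into each entry of the tuple `f`: this is `f(a)`. -/
def comp (f : n → MvPowerSeries m R) (a : m → MvPowerSeries τ R) : n → MvPowerSeries τ R :=
  fun i => subst a (f i)

/-- The tuple `(X_{e i})_i` of variables. -/
def var (R : Type u) [CommRing R] (e : n → τ) : n → MvPowerSeries τ R := fun i => X (e i)

/-- A tuple of power series without constant terms. -/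
def Pointed (a : n → MvPowerSeries τ R) : Prop := ∀ i, constantCoeff (a i) = 0

theorem Pointed.hasSubst [Finite n] {a : n → MvPowerSeries τ R} (ha : Pointed a) : HasSubst a :=
  hasSubst_of_constantCoeff_zero ha

theorem Pointed.zero : Pointed (0 : n → MvPowerSeries τ R) := fun _ => by simp

theorem Pointed.var (e : n → τ) : Pointed (var R e) := fun i => by simp [PowerSeriesTuple.var]

theorem Pointed.elim {a : m → MvPowerSeries τ R} {b : n → MvPowerSeries τ R} (ha : Pointed a)
    (hb : Pointed b) : Pointed (Sum.elim a b) := by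
  rintro (i | i)
  · exact ha i
  · exact hb i

theorem Pointed.comp [Finite m] {f : n → MvPowerSeries m R} {a : m → MvPowerSeries τ R}
    (hf : Pointed f) (ha : Pointed a) : Pointed (comp f a) := fun i =>
  constantCoeff_subst_eq_zero ha.hasSubst ha (hf i)

theorem comp_assoc [Finite m] [Finite σ] (f : n → MvPowerSeries m R)
    {a : m → MvPowerSeries σ R} {b : σ → MvPowerSeries τ R} (ha : Pointed a) (hb : Pointed b) :
    comp (comp f a) b = comp f (comp a b) := by
  funext i
  exact subst_comp_subst_apply ha.hasSubst hb.hasSubst (f i)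

theorem var_comp [Finite m] (e : n → m) {a : m → MvPowerSeries τ R} (ha : Pointed a) :
    comp (var R e) a = a ∘ e := by
  funext i
  exact subst_X ha.hasSubst (e i)

theorem comp_var_id (f : n → MvPowerSeries m R) : comp f (var R id) = f := by
  funext i
  exact congrFun (subst_self (σ := m) (R := R)) (f i)

theorem zero_comp [Finite m] {a : m → MvPowerSeries τ R} (ha : Pointed a) :
    comp (0 : n → MvPowerSeries m R) a = 0 := by
  funext i
  change subst a (0 : MvPowerSeries m R) = 0
  rw [← substAlgHom_apply ha.hasSubst, map_zero]

theorem elim_comp (a : m → MvPowerSeries σ R) (b : n → MvPowerSeries σ R)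
    (c : σ → MvPowerSeries τ R) :
    comp (Sum.elim a b) c = Sum.elim (comp a c) (comp b c) := by
  funext i
  cases i <;> rfl

end PowerSeriesTuple

open PowerSeriesTuple

/-! ### Commutative formal groups -/

/-- A commutative formal group (law) over `R` of finite dimension `dim`: a tuple
`F(X, Y) = (F_i(X, Y))_i` of power series in `X = (X_i)_i` and `Y = (Y_i)_i` without constant terms
such that `F(X, 0) = X`, `F(F(X, Y), Z) = F(X, F(Y, Z))` and `F(X, Y) = F(Y, X)`.
The variables `X_i`, `Y_i` are indexed by `Sum.inl i`, `Sum.inr i`. -/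
structure CommFormalGroup (R : Type u) [CommRing R] where
  dim : ℕ
  law : Fin dim → MvPowerSeries (Fin dim ⊕ Fin dim) R
  pointed : Pointed law
  law_zero : comp law (Sum.elim (var R id) 0) = var R id
  law_assoc :
    comp law (Sum.elim
        (comp law (Sum.elim (var R fun i => ((0 : Fin 3), i)) (var R fun i => ((1 : Fin 3), i))))
        (var R fun i => ((2 : Fin 3), i))) =
      comp law (Sum.elim (var R fun i => ((0 : Fin 3), i))
        (comp law (Sum.elim (var R fun i => ((1 : Fin 3), i)) (var R fun i => ((2 : Fin 3), i)))))
  law_comm : comp law (Sum.elim (var R Sum.inr) (var R Sum.inl)) = law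

namespace CommFormalGroup

variable {R : Type u} [CommRing R]

/-- `F.add a b` is `F(a, b)`. -/
def add (F : CommFormalGroup R) {τ : Type} (a b : Fin F.dim → MvPowerSeries τ R) :
    Fin F.dim → MvPowerSeries τ R :=
  comp F.law (Sum.elim a b)

/-- A homomorphism `F ⟶ G`: a tuple `f` of power series without constant terms such that
`f(F(X, Y)) = G(f(X), f(Y))`. -/
@[ext]
structure Hom (F G : CommFormalGroup R) where
  toFun : Fin G.dim → MvPowerSeries (Fin F.dim) R
  pointed : Pointed toFun
  map_law : comp toFun F.law = G.add (comp toFun (var R Sum.inl)) (comp toFun (var R Sum.inr))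

section Points

variable (F : CommFormalGroup R) {σ τ : Type}

theorem pointed_add {a b : Fin F.dim → MvPowerSeries τ R} (ha : Pointed a) (hb : Pointed b) :
    Pointed (F.add a b) :=
  F.pointed.comp (ha.elim hb)

theorem add_comp [Finite σ] {a b : Fin F.dim → MvPowerSeries σ R} {c : σ → MvPowerSeries τ R}
    (ha : Pointed a) (hb : Pointed b) (hc : Pointed c) :
    comp (F.add a b) c = F.add (comp a c) (comp b c) := by
  rw [add, comp_assoc _ (ha.elim hb) hc, elim_comp, add]

theorem law_eq_add : F.law = F.add (var R Sum.inl) (var R Sum.inr) := by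
  have h : Sum.elim (var R Sum.inl) (var R Sum.inr) =
      (var R id : Fin F.dim ⊕ Fin F.dim → MvPowerSeries _ R) := by
    funext i
    cases i <;> rfl
  rw [add, h, comp_var_id]

theorem add_zero {a : Fin F.dim → MvPowerSeries τ R} (ha : Pointed a) : F.add a 0 = a := by
  have h := congrArg (fun f => comp f a) F.law_zero
  change comp F.law (Sum.elim a 0) = a
  simpa [comp_assoc _ ((Pointed.var id).elim Pointed.zero) ha, elim_comp, var_comp _ ha,
    zero_comp ha] using h

theorem add_comm {a b : Fin F.dim → MvPowerSeries τ R} (ha : Pointed a) (hb : Pointed b) :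
    F.add b a = F.add a b := by
  have h := congrArg (fun f => comp f (Sum.elim a b)) F.law_comm
  change comp F.law (Sum.elim b a) = comp F.law (Sum.elim a b)
  simpa [comp_assoc _ ((Pointed.var (R := R) Sum.inr).elim (Pointed.var (R := R) Sum.inl))
    (ha.elim hb), elim_comp, var_comp _ (ha.elim hb)] using h

theorem add_assoc {a b c : Fin F.dim → MvPowerSeries τ R} (ha : Pointed a) (hb : Pointed b)
    (hc : Pointed c) : F.add (F.add a b) c = F.add a (F.add b c) := by
  let d : Fin 3 × Fin F.dim → MvPowerSeries τ R := fun p => ![a, b, c] p.1 p.2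
  have hd : Pointed d := by
    rintro ⟨i, j⟩
    fin_cases i
    exacts [ha j, hb j, hc j]
  have hv (i : Fin 3) : Pointed (var R fun j : Fin F.dim => (i, j)) := Pointed.var _
  have h := congrArg (fun f => comp f d) F.law_assoc
  change comp (F.add (F.add _ _) _) d = comp (F.add _ (F.add _ _)) d at h
  rw [F.add_comp (F.pointed_add (hv 0) (hv 1)) (hv 2) hd, F.add_comp (hv 0) (hv 1) hd,
    F.add_comp (hv 0) (F.pointed_add (hv 1) (hv 2)) hd, F.add_comp (hv 1) (hv 2) hd,
    var_comp _ hd, var_comp _ hd, var_comp _ hd] at h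
  exact h

variable {F}

theorem Hom.map_add {G : CommFormalGroup R} (f : Hom F G) {a b : Fin F.dim → MvPowerSeries τ R}
    (ha : Pointed a) (hb : Pointed b) :
    comp f.toFun (F.add a b) = G.add (comp f.toFun a) (comp f.toFun b) := by
  have h := congrArg (fun g => comp g (Sum.elim a b)) f.map_law
  have hl : Pointed (var R (Sum.inl : Fin F.dim → Fin F.dim ⊕ Fin F.dim)) := Pointed.var _
  have hr : Pointed (var R (Sum.inr : Fin F.dim → Fin F.dim ⊕ Fin F.dim)) := Pointed.var _
  have hab := ha.elim hb
  change comp f.toFun (comp F.law (Sum.elim a b)) = _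
  simpa only [comp_assoc _ F.pointed hab, G.add_comp (f.pointed.comp hl) (f.pointed.comp hr) hab,
    comp_assoc _ hl hab, comp_assoc _ hr hab, var_comp _ hab, Sum.elim_comp_inl,
    Sum.elim_comp_inr] using h

/-- To be a homomorphism it suffices to be additive on all pointed tuples. -/
def Hom.mk' {G : CommFormalGroup R} (f : Fin G.dim → MvPowerSeries (Fin F.dim) R)
    (hf : Pointed f)
    (h : ∀ a b : Fin F.dim → MvPowerSeries (Fin F.dim ⊕ Fin F.dim) R, Pointed a → Pointed b →
      comp f (F.add a b) = G.add (comp f a) (comp f b)) : Hom F G where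
  toFun := f
  pointed := hf
  map_law := by
    conv_lhs => rw [F.law_eq_add]
    exact h _ _ (Pointed.var _) (Pointed.var _)

end Points

/-- The category of commutative formal groups over `R`; composition is substitution. -/
instance : Category.{u} (CommFormalGroup R) where
  Hom := Hom
  id F := Hom.mk' (var R id) (Pointed.var _) fun a b ha hb => by
    rw [var_comp _ (F.pointed_add ha hb), var_comp _ ha, var_comp _ hb]
    rfl
  comp {F G H} f g := Hom.mk' (comp g.toFun f.toFun) (g.pointed.comp f.pointed)
    fun a b ha hb => by
      rw [comp_assoc _ f.pointed (F.pointed_add ha hb), f.map_add ha hb,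
        g.map_add (f.pointed.comp ha) (f.pointed.comp hb), comp_assoc _ f.pointed ha,
        comp_assoc _ f.pointed hb]
  id_comp f := Hom.ext (comp_var_id _)
  comp_id f := Hom.ext (var_comp _ f.pointed)
  assoc f g h := Hom.ext (comp_assoc _ g.pointed f.pointed).symm

theorem hom_ext {F G : CommFormalGroup R} {f g : F ⟶ G} (h : f.toFun = g.toFun) : f = g :=
  Hom.ext h

theorem comp_toFun {F G H : CommFormalGroup R} (f : F ⟶ G) (g : G ⟶ H) :
    (f ≫ g).toFun = comp g.toFun f.toFun := rfl

/-! ### Finite products of commutative formal groups -/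

instance : HasTerminal (CommFormalGroup R) := by
  let T : CommFormalGroup R :=
    { dim := 0
      law := Fin.elim0
      pointed := fun i => i.elim0
      law_zero := funext fun i => i.elim0
      law_assoc := funext fun i => i.elim0
      law_comm := funext fun i => i.elim0 }
  have (F : CommFormalGroup R) : Unique (F ⟶ T) :=
    { default :=
        { toFun := Fin.elim0
          pointed := fun i => i.elim0
          map_law := funext fun i => i.elim0 }
      uniq := fun f => hom_ext (funext fun i => i.elim0) }
  exact hasTerminal_of_unique T

section Prod

variable (F G : CommFormalGroup R) {τ : Type}

theorem append_comp {m n : ℕ} {σ : Type} (a : Fin m → MvPowerSeries σ R)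
    (b : Fin n → MvPowerSeries σ R) (c : σ → MvPowerSeries τ R) :
    comp (Fin.append a b) c = Fin.append (comp a c) (comp b c) := by
  funext i
  refine Fin.addCases (fun i => ?_) (fun i => ?_) i <;> simp [comp]

theorem pointed_append {m n : ℕ} {a : Fin m → MvPowerSeries τ R}
    {b : Fin n → MvPowerSeries τ R} (ha : Pointed a) (hb : Pointed b) :
    Pointed (Fin.append a b) := by
  refine Fin.addCases (fun i => ?_) (fun i => ?_)
  · simpa using ha i
  · simpa using hb i

theorem pointed_comp_right {m n : Type} {a : m → MvPowerSeries τ R} (ha : Pointed a) (e : n → m) :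
    Pointed (a ∘ e) := fun i => ha (e i)

/-- The law `(F(X', Y'), G(X'', Y''))` of the product, with `X = (X', X'')`, `Y = (Y', Y'')`. -/
def prodLaw : Fin (F.dim + G.dim) → MvPowerSeries (Fin (F.dim + G.dim) ⊕ Fin (F.dim + G.dim)) R :=
  Fin.append
    (F.add (var R fun i => Sum.inl (Fin.castAdd _ i)) (var R fun i => Sum.inr (Fin.castAdd _ i)))
    (G.add (var R fun i => Sum.inl (Fin.natAdd _ i)) (var R fun i => Sum.inr (Fin.natAdd _ i)))

theorem prodLaw_comp {a b : Fin (F.dim + G.dim) → MvPowerSeries τ R} (ha : Pointed a)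
    (hb : Pointed b) :
    comp (prodLaw F G) (Sum.elim a b) =
      Fin.append (F.add (a ∘ Fin.castAdd _) (b ∘ Fin.castAdd _))
        (G.add (a ∘ Fin.natAdd _) (b ∘ Fin.natAdd _)) := by
  have hab := ha.elim hb
  rw [prodLaw, append_comp, F.add_comp (Pointed.var _) (Pointed.var _) hab,
    G.add_comp (Pointed.var _) (Pointed.var _) hab, var_comp _ hab, var_comp _ hab,
    var_comp _ hab, var_comp _ hab]
  rfl

theorem append_castAdd {m n : ℕ} {α : Type*} (a : Fin m → α) (b : Fin n → α) :
    Fin.append a b ∘ Fin.castAdd n = a := by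
  funext i
  simp

theorem append_natAdd {m n : ℕ} {α : Type*} (a : Fin m → α) (b : Fin n → α) :
    Fin.append a b ∘ Fin.natAdd m = b := by
  funext i
  simp

theorem append_eta {m n : ℕ} {α : Type*} (a : Fin (m + n) → α) :
    Fin.append (a ∘ Fin.castAdd n) (a ∘ Fin.natAdd m) = a := by
  funext i
  refine Fin.addCases (fun i => ?_) (fun i => ?_) i <;> simp

theorem pointed_prodLaw : Pointed (prodLaw F G) :=
  pointed_append (F.pointed_add (Pointed.var _) (Pointed.var _))
    (G.pointed_add (Pointed.var _) (Pointed.var _))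

/-- The product of two commutative formal groups. -/
def prod : CommFormalGroup R where
  dim := F.dim + G.dim
  law := prodLaw F G
  pointed := pointed_prodLaw F G
  law_zero := by
    rw [prodLaw_comp F G (Pointed.var _) Pointed.zero]
    change Fin.append (F.add _ 0) (G.add _ 0) = _
    rw [F.add_zero (pointed_comp_right (Pointed.var _) _),
      G.add_zero (pointed_comp_right (Pointed.var _) _), append_eta]
  law_assoc := by
    have h (i : Fin 3) : Pointed (var R fun j : Fin (F.dim + G.dim) => (i, j)) := Pointed.var _
    have hc (i : Fin 3) := pointed_comp_right (h i) (Fin.castAdd G.dim)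
    have hn (i : Fin 3) := pointed_comp_right (h i) (Fin.natAdd F.dim)
    have hp (i j : Fin 3) := (pointed_prodLaw F G).comp ((h i).elim (h j))
    rw [prodLaw_comp F G (hp 0 1) (h 2), prodLaw_comp F G (h 0) (hp 1 2),
      prodLaw_comp F G (h 0) (h 1), prodLaw_comp F G (h 1) (h 2)]
    simp only [append_castAdd, append_natAdd]
    rw [F.add_assoc (hc 0) (hc 1) (hc 2), G.add_assoc (hn 0) (hn 1) (hn 2)]
  law_comm := by
    rw [prodLaw_comp F G (Pointed.var _) (Pointed.var _),
      F.add_comm (pointed_comp_right (Pointed.var _) _) (pointed_comp_right (Pointed.var _) _),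
      G.add_comm (pointed_comp_right (Pointed.var _) _) (pointed_comp_right (Pointed.var _) _)]
    rfl

theorem prod_add {a b : Fin (prod F G).dim → MvPowerSeries τ R} (ha : Pointed a)
    (hb : Pointed b) :
    (prod F G).add a b = Fin.append (F.add (a ∘ Fin.castAdd _) (b ∘ Fin.castAdd _))
        (G.add (a ∘ Fin.natAdd _) (b ∘ Fin.natAdd _)) :=
  prodLaw_comp F G ha hb

/-- The first projection. -/
def prodFst : prod F G ⟶ F :=
  Hom.mk' (var R (Fin.castAdd _)) (Pointed.var _) fun _ _ ha hb =>
    (var_comp _ ((prod F G).pointed_add ha hb)).trans <|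
      (congrArg (fun c : Fin (F.dim + G.dim) → _ => c ∘ Fin.castAdd _) (prod_add F G ha hb)).trans <|
      (append_castAdd _ _).trans (congrArg₂ F.add (var_comp _ ha) (var_comp _ hb)).symm

/-- The second projection. -/
def prodSnd : prod F G ⟶ G :=
  Hom.mk' (var R (Fin.natAdd _)) (Pointed.var _) fun _ _ ha hb =>
    (var_comp _ ((prod F G).pointed_add ha hb)).trans <|
      (congrArg (fun c : Fin (F.dim + G.dim) → _ => c ∘ Fin.natAdd _) (prod_add F G ha hb)).trans <|
      (append_natAdd _ _).trans (congrArg₂ G.add (var_comp _ ha) (var_comp _ hb)).symm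

variable {F G}

/-- The homomorphism to a product with the given components. -/
def prodLift {H : CommFormalGroup R} (f : H ⟶ F) (g : H ⟶ G) : H ⟶ prod F G :=
  Hom.mk' (Fin.append f.toFun g.toFun) (pointed_append f.pointed g.pointed) fun a b ha hb => by
    have hp := pointed_append f.pointed g.pointed
    have h₁ (c : Fin H.dim → MvPowerSeries (Fin H.dim ⊕ Fin H.dim) R) := (congrArg (· ∘ Fin.castAdd _)
      (append_comp f.toFun g.toFun c)).trans (append_castAdd _ _)
    have h₂ (c : Fin H.dim → MvPowerSeries (Fin H.dim ⊕ Fin H.dim) R) := (congrArg (· ∘ Fin.natAdd _)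
      (append_comp f.toFun g.toFun c)).trans (append_natAdd _ _)
    refine ((append_comp _ _ _).trans ?_).trans (prod_add F G (hp.comp ha) (hp.comp hb)).symm
    exact congrArg₂ Fin.append
      ((f.map_add ha hb).trans (congrArg₂ F.add (h₁ a) (h₁ b)).symm)
      ((g.map_add ha hb).trans (congrArg₂ G.add (h₂ a) (h₂ b)).symm)

theorem prodLift_fst {H : CommFormalGroup R} (f : H ⟶ F) (g : H ⟶ G) :
    prodLift f g ≫ prodFst F G = f :=
  hom_ext <| (var_comp _ (prodLift f g).pointed).trans (append_castAdd _ _)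

theorem prodLift_snd {H : CommFormalGroup R} (f : H ⟶ F) (g : H ⟶ G) :
    prodLift f g ≫ prodSnd F G = g :=
  hom_ext <| (var_comp _ (prodLift f g).pointed).trans (append_natAdd _ _)

theorem prod_hom_ext {H : CommFormalGroup R} {f g : H ⟶ prod F G}
    (h₁ : f ≫ prodFst F G = g ≫ prodFst F G) (h₂ : f ≫ prodSnd F G = g ≫ prodSnd F G) :
    f = g := by
  have e₁ (f : H ⟶ prod F G) : (f ≫ prodFst F G).toFun = f.toFun ∘ Fin.castAdd _ :=
    var_comp _ f.pointed
  have e₂ (f : H ⟶ prod F G) : (f ≫ prodSnd F G).toFun = f.toFun ∘ Fin.natAdd _ :=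
    var_comp _ f.pointed
  refine hom_ext ?_
  have k₁ := (e₁ f).symm.trans ((congrArg Hom.toFun h₁).trans (e₁ g))
  have k₂ := (e₂ f).symm.trans ((congrArg Hom.toFun h₂).trans (e₂ g))
  funext i
  refine Fin.addCases (fun i => ?_) (fun i => ?_) i
  · exact congrFun k₁ i
  · exact congrFun k₂ i

variable (F G)

/-- `prod F G` is the product of `F` and `G` in the category of commutative formal groups. -/
def prodIsLimit : IsLimit (BinaryFan.mk (prodFst F G) (prodSnd F G)) :=
  BinaryFan.isLimitMk (fun s => prodLift s.fst s.snd) (fun s => prodLift_fst s.fst s.snd)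
    (fun s => prodLift_snd s.fst s.snd)
    (fun s _ h₁ h₂ => prod_hom_ext (h₁.trans (prodLift_fst s.fst s.snd).symm)
      (h₂.trans (prodLift_snd s.fst s.snd).symm))

end Prod

instance : HasBinaryProducts (CommFormalGroup R) :=
  have (F G : CommFormalGroup R) : HasLimit (pair F G) := ⟨⟨⟨_, prodIsLimit F G⟩⟩⟩
  hasBinaryProducts_of_hasLimit_pair _

/-! ### Products of one-dimensional formal groups -/

/-- `F` is a (finite) product of one-dimensional commutative formal groups. -/
def IsProductOfOneDim (R : Type u) [CommRing R] : ObjectProperty (CommFormalGroup R) := fun F =>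
  ∃ (ι : Type) (_ : Finite ι) (G : ι → CommFormalGroup R) (π : ∀ i, F ⟶ G i),
    (∀ i, (G i).dim = 1) ∧ Nonempty (IsLimit (Fan.mk F π))

end CommFormalGroup

/-- The category of commutative formal groups that are products of one-dimensional formal groups,
a full subcategory of the category of all commutative formal groups. -/
abbrev FG (R : Type u) [CommRing R] : Type u :=
  (CommFormalGroup.IsProductOfOneDim R).FullSubcategory

namespace FG

variable (R : Type u) [CommRing R]

open CommFormalGroup

instance : (IsProductOfOneDim R).IsClosedUnderLimitsOfShape (Discrete PEmpty.{1}) where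
  limitsOfShape_le := by
    rintro F ⟨p⟩
    refine ⟨PEmpty, inferInstance, PEmpty.elim, fun i => i.elim, fun i => i.elim, ⟨?_⟩⟩
    refine Fan.IsLimit.mk _ (fun s => p.isLimit.lift ⟨s.pt, { app := fun j => j.as.elim }⟩)
      (fun s j => j.elim) (fun s m _ => p.isLimit.hom_ext fun j => j.as.elim)

instance : (IsProductOfOneDim R).IsClosedUnderLimitsOfShape (Discrete WalkingPair) where
  limitsOfShape_le := by
    rintro F ⟨p⟩
    obtain ⟨ι₁, _, G₁, π₁, h₁, ⟨l₁⟩⟩ := p.prop_diag_obj ⟨WalkingPair.left⟩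
    obtain ⟨ι₂, _, G₂, π₂, h₂, ⟨l₂⟩⟩ := p.prop_diag_obj ⟨WalkingPair.right⟩
    let bc : BinaryFan (Fan.mk _ π₁).pt (Fan.mk _ π₂).pt :=
      BinaryFan.mk (P := F) (p.π.app ⟨WalkingPair.left⟩) (p.π.app ⟨WalkingPair.right⟩)
    let cone (s : BinaryFan _ _) : Cone p.diag := ⟨s.pt, Discrete.natTrans (fun j => match j with
      | ⟨WalkingPair.left⟩ => s.fst
      | ⟨WalkingPair.right⟩ => s.snd)⟩
    have hbc : IsLimit bc := BinaryFan.isLimitMk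
      (fun s => p.isLimit.lift (cone s))
      (fun s => p.isLimit.fac (cone s) ⟨WalkingPair.left⟩)
      (fun s => p.isLimit.fac (cone s) ⟨WalkingPair.right⟩)
      (fun s m e₁ e₂ => p.isLimit.hom_ext (by
        rintro ⟨_ | _⟩
        · exact e₁.trans (p.isLimit.fac (cone s) ⟨WalkingPair.left⟩).symm
        · exact e₂.trans (p.isLimit.fac (cone s) ⟨WalkingPair.right⟩).symm))
    exact ⟨ι₁ ⊕ ι₂, inferInstance, Sum.elim G₁ G₂, _, by rintro (i | i) <;> simp [h₁, h₂],
      ⟨Fan.combPairIsLimit l₁ l₂ hbc⟩⟩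

instance : HasFiniteProducts (FG R) :=
  hasFiniteProducts_of_has_binary_and_terminal

end FG

/-! ### The Grothendieck group of a category with finite products -/

/-- The isomorphism classes of objects of `C`. -/
def IsoClass (C : Type u) [Category.{v} C] : Type u := Quotient (isIsomorphicSetoid C)

namespace IsoClass

variable {C : Type u} [Category.{v} C]

/-- The isomorphism class of an object. -/
def of (X : C) : IsoClass C := Quotient.mk _ X

variable [HasFiniteProducts C]

instance : Zero (IsoClass C) := ⟨of (⊤_ C)⟩

instance : Add (IsoClass C) :=
  ⟨Quotient.map₂ (fun X Y => X ⨯ Y) fun _ _ ⟨e⟩ _ _ ⟨e'⟩ => ⟨prod.mapIso e e'⟩⟩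

/-- Isomorphism classes form a commutative monoid under `[X] + [Y] = [X ⨯ Y]`, whose zero is the
class of the terminal object. -/
instance : AddCommMonoid (IsoClass C) where
  add_assoc := by
    rintro ⟨X⟩ ⟨Y⟩ ⟨Z⟩
    exact Quotient.sound ⟨prod.associator X Y Z⟩
  zero_add := by
    rintro ⟨X⟩
    exact Quotient.sound ⟨prod.leftUnitor X⟩
  add_zero := by
    rintro ⟨X⟩
    exact Quotient.sound ⟨prod.rightUnitor X⟩
  add_comm := by
    rintro ⟨X⟩ ⟨Y⟩
    exact Quotient.sound ⟨prod.braiding X Y⟩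
  nsmul := nsmulRec

end IsoClass

/-- The Grothendieck group `K₀(C)` of a category with finite products: the group completion of the
monoid of isomorphism classes of objects. -/
abbrev K0 (C : Type u) [Category.{v} C] [HasFiniteProducts C] : Type u :=
  Algebra.GrothendieckAddGroup (IsoClass C)

end

/-! Freeness is a Krull–Schmidt statement that reduces to linear algebra. A homomorphism has a
Jacobian at the origin, multiplicative under composition; between one-dimensional groups over a
field, a homomorphism with nonzero Jacobian is an isomorphism, by inverting power series. If a
product of the `G i` is isomorphic to a product of the `H j`, the Jacobian of the isomorphism
becomes an invertible square matrix whose entries are the Jacobians of the components `G i ⟶ H j`.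
Some term of the Leibniz expansion of its determinant is nonzero, and the permutation of that term
matches the factors up to isomorphism (`exists_equiv_of_iso`). Hence the monoid of isomorphism
classes is free commutative on the one-dimensional classes (`sumHom_bijective`), and its group
completion is free abelian on them.

In characteristic `p`, infinitely many one-dimensional classes are separated by height. For each `h`
there is a Lubin–Tate group over `ℤ_[p]` in which multiplication by `p` is `p X + X ^ (p ^ (h +
1))`; after reduction it is `X ^ (p ^ (h + 1))`. A homomorphism with nonzero linear term commutes
with multiplication by `p`, and comparing lowest degrees bounds one exponent by the other
(`le_of_hom`). -/

noncomputable section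

open CategoryTheory CategoryTheory.Limits PowerSeriesTuple

/-! ### The order filtration on power series and its behaviour under substitution. -/

namespace MvPowerSeries

variable {R : Type u} [CommRing R] {σ τ : Type}

/-- The ideal of power series all of whose terms have degree at least `d`. -/
def orderIdeal (σ : Type) (R : Type u) [CommRing R] (d : ℕ) : Ideal (MvPowerSeries σ R) where
  carrier := {φ | (d : ℕ∞) ≤ φ.order}
  zero_mem' := by simp
  add_mem' ha hb := (le_min ha hb).trans min_order_le_add
  smul_mem' c φ h := le_trans (by simpa using le_add_left h) (le_order_mul (f := c) (g := φ))

theorem mem_orderIdeal_iff_le_order {d : ℕ} {φ : MvPowerSeries σ R} :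
    φ ∈ orderIdeal σ R d ↔ (d : ℕ∞) ≤ φ.order := Iff.rfl

theorem mem_orderIdeal {d : ℕ} {φ : MvPowerSeries σ R} :
    φ ∈ orderIdeal σ R d ↔ ∀ m : σ →₀ ℕ, m.degree < d → coeff m φ = 0 :=
  ⟨fun h _ hm => coeff_of_lt_order (lt_of_lt_of_le (by exact_mod_cast hm) h), nat_le_order⟩

theorem orderIdeal_anti {a b : ℕ} (h : a ≤ b) : orderIdeal σ R b ≤ orderIdeal σ R a :=
  fun _ hφ => le_trans (by exact_mod_cast h) (mem_orderIdeal_iff_le_order.1 hφ)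

theorem mem_orderIdeal_one {φ : MvPowerSeries σ R} :
    φ ∈ orderIdeal σ R 1 ↔ constantCoeff φ = 0 := by
  rw [mem_orderIdeal_iff_le_order, Nat.cast_one, one_le_order_iff_constCoeff_eq_zero]

theorem mul_mem_orderIdeal {a b : ℕ} {φ ψ : MvPowerSeries σ R} (hφ : φ ∈ orderIdeal σ R a)
    (hψ : ψ ∈ orderIdeal σ R b) : φ * ψ ∈ orderIdeal σ R (a + b) := by
  rw [mem_orderIdeal_iff_le_order] at *
  push_cast
  exact (add_le_add hφ hψ).trans le_order_mul

theorem pow_mem_orderIdeal {φ : MvPowerSeries σ R} (hφ : φ ∈ orderIdeal σ R 1) (n : ℕ) :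
    φ ^ n ∈ orderIdeal σ R n := by
  induction n with
  | zero => simp [mem_orderIdeal_iff_le_order]
  | succ n ih => rw [pow_succ]; exact mul_mem_orderIdeal ih hφ

/-- For `n > 0`, factoring out `φ - ψ` leaves products of `n - 1` series of order at least one,
which raises the order from `d + 1` to `n + d`. -/
theorem pow_sub_pow_mem_orderIdeal {φ ψ : MvPowerSeries σ R} (hφ : φ ∈ orderIdeal σ R 1)
    (hψ : ψ ∈ orderIdeal σ R 1) {d : ℕ} (h : φ - ψ ∈ orderIdeal σ R (d + 1)) (n : ℕ) :
    φ ^ n - ψ ^ n ∈ orderIdeal σ R (n + d) := by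
  induction n with
  | zero => simp
  | succ n ih =>
    have e : φ ^ (n + 1) - ψ ^ (n + 1) = φ ^ n * (φ - ψ) + (φ ^ n - ψ ^ n) * ψ := by ring
    rw [e]
    refine add_mem ?_ ?_
    · convert mul_mem_orderIdeal (pow_mem_orderIdeal hφ n) h using 2; ring
    · convert mul_mem_orderIdeal ih hψ using 2; ring

theorem prod_pow_mem_orderIdeal {a : σ → MvPowerSeries τ R} (ha : Pointed a) (m : σ →₀ ℕ) :
    (m.prod fun s e => a s ^ e) ∈ orderIdeal τ R m.degree := by
  classical
  induction m using Finsupp.induction_linear with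
  | zero => simp [mem_orderIdeal_iff_le_order]
  | single s n =>
    rw [Finsupp.prod_single_index (h := fun s e => a s ^ e) (pow_zero _), Finsupp.degree_single]
    exact pow_mem_orderIdeal (mem_orderIdeal_one.2 (ha s)) n
  | add m n hm hn =>
    rw [Finsupp.prod_add_index' (by simp) (fun _ _ _ => pow_add _ _ _), map_add]
    exact mul_mem_orderIdeal hm hn

theorem prod_pow_sub_mem_orderIdeal {a b : σ → MvPowerSeries τ R} (ha : Pointed a)
    (hb : Pointed b) (h : ∀ i, a i - b i ∈ orderIdeal τ R 2) (m : σ →₀ ℕ) :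
    (m.prod fun s e => a s ^ e) - (m.prod fun s e => b s ^ e) ∈
      orderIdeal τ R (m.degree + 1) := by
  classical
  induction m using Finsupp.induction_linear with
  | zero => simp
  | single s n =>
    rw [Finsupp.prod_single_index (h := fun s e => a s ^ e) (pow_zero _),
      Finsupp.prod_single_index (h := fun s e => b s ^ e) (pow_zero _), Finsupp.degree_single]
    exact pow_sub_pow_mem_orderIdeal (mem_orderIdeal_one.2 (ha s)) (mem_orderIdeal_one.2 (hb s))
      (h s) n
  | add m n hm hn =>
    rw [Finsupp.prod_add_index' (by simp) (fun _ _ _ => pow_add _ _ _),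
      Finsupp.prod_add_index' (by simp) (fun _ _ _ => pow_add _ _ _), map_add]
    have e (x y z w : MvPowerSeries τ R) : x * y - z * w = (x - z) * y + z * (y - w) := by ring
    rw [e]
    refine add_mem ?_ ?_
    · convert mul_mem_orderIdeal hm (prod_pow_mem_orderIdeal ha n) using 2; ring
    · convert mul_mem_orderIdeal (prod_pow_mem_orderIdeal hb m) hn using 2; ring

theorem subst_mem_orderIdeal [Finite σ] {a : σ → MvPowerSeries τ R} (ha : Pointed a) {d : ℕ}
    {φ : MvPowerSeries σ R} (h : φ ∈ orderIdeal σ R d) : subst a φ ∈ orderIdeal τ R d := by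
  rw [mem_orderIdeal]
  intro e he
  rw [coeff_subst ha.hasSubst]
  refine finsum_eq_zero_of_forall_eq_zero fun m => ?_
  by_cases hm : m.degree < d
  · rw [mem_orderIdeal.1 h m hm, zero_smul]
  · rw [mem_orderIdeal.1 (prod_pow_mem_orderIdeal ha m) e (by omega), smul_zero]

/-- Monomials of degree `d` or more in `a` and in `b` differ only in higher degree, so the
degree-`d` form of `φ(a)` sees only the linear part of `a`. This lets degree-by-degree corrections
be computed with a linear substitution. -/
theorem subst_sub_subst_mem_orderIdeal [Finite σ] {a b : σ → MvPowerSeries τ R} (ha : Pointed a)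
    (hb : Pointed b) (hab : ∀ i, a i - b i ∈ orderIdeal τ R 2) {d : ℕ}
    {φ : MvPowerSeries σ R} (h : φ ∈ orderIdeal σ R d) :
    subst a φ - subst b φ ∈ orderIdeal τ R (d + 1) := by
  rw [mem_orderIdeal]
  intro e he
  rw [map_sub, coeff_subst ha.hasSubst, coeff_subst hb.hasSubst, sub_eq_zero]
  refine finsum_congr fun m => ?_
  by_cases hm : m.degree < d
  · rw [mem_orderIdeal.1 h m hm, zero_smul, zero_smul]
  · have := mem_orderIdeal.1 (prod_pow_sub_mem_orderIdeal ha hb hab m) e (by omega)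
    rw [map_sub, sub_eq_zero] at this
    rw [this]

/-- The leading form of `φ(a)` when `a ≡ c X` modulo degree two. -/
theorem coeff_subst_of_mem_orderIdeal [Finite σ] {a : σ → MvPowerSeries σ R} (ha : Pointed a)
    {c : R} (hac : ∀ i, a i - c • X i ∈ orderIdeal σ R 2) {d : ℕ} {φ : MvPowerSeries σ R}
    (h : φ ∈ orderIdeal σ R d) {e : σ →₀ ℕ} (he : e.degree = d) :
    coeff e (subst a φ) = c ^ d * coeff e φ := by
  have hb : Pointed fun i : σ => c • (X i : MvPowerSeries σ R) := fun i => by simp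
  have := mem_orderIdeal.1 (subst_sub_subst_mem_orderIdeal ha hb hac h) e (by omega)
  rw [map_sub, sub_eq_zero] at this
  have hr := rescale_eq_subst (fun _ : σ => c) φ
  rw [this]
  have hX : (fun i : σ => c • (X i : MvPowerSeries σ R)) = (fun _ : σ => c) • X := rfl
  rw [hX, ← hr, coeff_rescale, Finsupp.prod, Finset.prod_pow_eq_pow_sum, ← he]
  rfl

/-- Successive approximation. -/
theorem exists_eq_zero_of_forall_exists (E : MvPowerSeries σ R → MvPowerSeries σ R)
    (hE : ∀ d φ ψ, φ - ψ ∈ orderIdeal σ R d → E φ - E ψ ∈ orderIdeal σ R d) {d₀ : ℕ}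
    {φ₀ : MvPowerSeries σ R} (h₀ : E φ₀ ∈ orderIdeal σ R d₀)
    (step : ∀ d, d₀ ≤ d → ∀ φ, φ - φ₀ ∈ orderIdeal σ R d₀ → E φ ∈ orderIdeal σ R d →
      ∃ ψ, ψ - φ ∈ orderIdeal σ R d ∧ E ψ ∈ orderIdeal σ R (d + 1)) :
    ∃ φ, φ - φ₀ ∈ orderIdeal σ R d₀ ∧ E φ = 0 := by
  -- The approximations carry both invariants, since `step` needs them at every stage of the
  -- recursion.
  let S (n : ℕ) := {φ : MvPowerSeries σ R // φ - φ₀ ∈ orderIdeal σ R d₀ ∧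
    E φ ∈ orderIdeal σ R (d₀ + n)}
  have next (n : ℕ) (φ : S n) : ∃ ψ : S (n + 1), ψ.1 - φ.1 ∈ orderIdeal σ R (d₀ + n) := by
    obtain ⟨ψ, h₁, h₂⟩ := step (d₀ + n) (by omega) φ.1 φ.2.1 φ.2.2
    refine ⟨⟨ψ, ?_, h₂⟩, h₁⟩
    have := add_mem (orderIdeal_anti (Nat.le_add_right d₀ n) h₁) φ.2.1
    rwa [sub_add_sub_cancel] at this
  choose g hg using next
  let s (n : ℕ) : S n := Nat.rec (motive := S) ⟨φ₀, by simp, h₀⟩ (fun n φ => g n φ) n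
  have hs (n : ℕ) : (s (n + 1)).1 - (s n).1 ∈ orderIdeal σ R (d₀ + n) := hg n (s n)
  have hs' (n j : ℕ) : (s (n + j)).1 - (s n).1 ∈ orderIdeal σ R (d₀ + n) := by
    induction j with
    | zero => simp
    | succ j ih =>
      have := add_mem (orderIdeal_anti (show d₀ + n ≤ d₀ + (n + j) by omega) (hs (n + j))) ih
      rwa [sub_add_sub_cancel] at this
  -- The limit: from stage `n` on, coefficients in degrees below `d₀ + n` no longer change, so stage
  -- `m.degree + 1` already has the final coefficient at `m`.
  let φ : MvPowerSeries σ R := fun m => coeff m (s (m.degree + 1)).1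
  have hφ (n : ℕ) : φ - (s n).1 ∈ orderIdeal σ R (d₀ + n) := by
    rw [mem_orderIdeal]
    intro m hm
    rw [map_sub, sub_eq_zero]
    change coeff m (s (m.degree + 1)).1 = _
    obtain h | h := le_total n (m.degree + 1)
    · obtain ⟨j, hj⟩ := Nat.exists_eq_add_of_le h
      rw [hj, ← sub_eq_zero, ← map_sub]
      exact mem_orderIdeal.1 (hs' n j) m hm
    · obtain ⟨j, hj⟩ := Nat.exists_eq_add_of_le h
      rw [hj, eq_comm, ← sub_eq_zero, ← map_sub]
      exact mem_orderIdeal.1 (hs' _ j) m (by omega)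
  refine ⟨φ, by simpa using add_mem (hφ 0) (s 0).2.1, ?_⟩
  ext m
  have h₁ := hE _ _ _ (hφ (m.degree + 1))
  have h₂ := add_mem h₁ (s (m.degree + 1)).2.2
  rw [sub_add_cancel] at h₂
  simpa using mem_orderIdeal.1 h₂ m (by omega)

theorem exists_eq_single_of_degree_eq_one {m : σ →₀ ℕ} (h : m.degree = 1) :
    ∃ i, m = Finsupp.single i 1 := by
  have : m ∈ Set.range fun i : σ => Finsupp.single i 1 := by rwa [Finsupp.range_single_one]
  obtain ⟨i, rfl⟩ := this
  exact ⟨i, rfl⟩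

/-- The chain rule at the origin: after removing its linear part, `φ` has order at least two, and so
does the result of substituting into it. -/
theorem coeff_single_subst [Fintype σ] {a : σ → MvPowerSeries τ R} (ha : Pointed a)
    {φ : MvPowerSeries σ R} (hφ : constantCoeff φ = 0) (j : τ) :
    coeff (Finsupp.single j 1) (subst a φ) =
      ∑ i, coeff (Finsupp.single i 1) φ * coeff (Finsupp.single j 1) (a i) := by
  classical
  have h : φ - ∑ i, coeff (Finsupp.single i 1) φ • (X i : MvPowerSeries σ R) ∈
      orderIdeal σ R 2 := by
    rw [mem_orderIdeal]
    intro m hm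
    obtain hm | hm : m.degree = 0 ∨ m.degree = 1 := by omega
    · obtain rfl := Finsupp.degree_eq_zero_iff _ |>.1 hm
      simpa using hφ
    · obtain ⟨i, rfl⟩ := exists_eq_single_of_degree_eq_one hm
      simp [coeff_X, Finsupp.single_left_inj]
  have h₁ := mem_orderIdeal.1 (subst_mem_orderIdeal ha h) (Finsupp.single j 1) (by simp)
  rw [← substAlgHom_apply ha.hasSubst, map_sub, map_sub, sub_eq_zero, substAlgHom_apply] at h₁
  rw [h₁]
  simp only [map_sum, map_smul, smul_eq_mul, substAlgHom_X]

end MvPowerSeries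

/-! ### Compositional inverses in one variable over a field. -/

namespace PowerSeriesTuple

open MvPowerSeries

variable {k : Type u} [Field k]

theorem exists_comp_eq_var_of_fin_one {f : Fin 1 → MvPowerSeries (Fin 1) k} (hf : Pointed f)
    (h : coeff (Finsupp.single 0 1) (f 0) ≠ 0) :
    ∃ g : Fin 1 → MvPowerSeries (Fin 1) k, Pointed g ∧ comp g f = var k id := by
  set c := coeff (Finsupp.single 0 1) (f 0) with hc
  have hfc (i : Fin 1) : f i - c • X i ∈ orderIdeal (Fin 1) k 2 := by
    obtain rfl := Subsingleton.elim i 0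
    rw [mem_orderIdeal]
    intro m hm
    obtain hm | hm : m.degree = 0 ∨ m.degree = 1 := by omega
    · obtain rfl := Finsupp.degree_eq_zero_iff _ |>.1 hm
      simpa using hf 0
    · obtain ⟨i, rfl⟩ := exists_eq_single_of_degree_eq_one hm
      obtain rfl := Subsingleton.elim i 0
      simp [hc]
  let E (φ : MvPowerSeries (Fin 1) k) := subst f φ - X 0
  have hE (φ ψ : MvPowerSeries (Fin 1) k) : E φ - E ψ = subst f (φ - ψ) := by
    rw [subst_sub hf.hasSubst]; simp [E]
  obtain ⟨φ, h₁, h₂⟩ := exists_eq_zero_of_forall_exists (d₀ := 1) (φ₀ := 0) E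
    (fun d φ ψ h => by rw [hE]; exact subst_mem_orderIdeal hf h)
    (by
      have : subst f (0 : MvPowerSeries (Fin 1) k) = 0 := by
        rw [← substAlgHom_apply hf.hasSubst, map_zero]
      simp [E, mem_orderIdeal_one, this])
    (fun d _ φ _ hφ => by
      -- A form `δ` of degree `d` contributes `c ^ d * δ` to the degree-`d` part of `δ(f)`; dividing
      -- the error by `c ^ d` makes it cancel.
      let δ : MvPowerSeries (Fin 1) k := fun m =>
        if m.degree = d then (c ^ d)⁻¹ * coeff m (E φ) else 0
      have hδ (m) : coeff m δ = if m.degree = d then (c ^ d)⁻¹ * coeff m (E φ) else 0 := rfl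
      have hδd : δ ∈ orderIdeal (Fin 1) k d := mem_orderIdeal.2 fun m hm => by
        rw [hδ, if_neg hm.ne]
      refine ⟨φ - δ, by simpa using hδd, mem_orderIdeal.2 fun m hm => ?_⟩
      have h₃ : E (φ - δ) = E φ - subst f δ := by
        have := hE (φ - δ) φ
        rw [sub_sub_cancel_left, ← substAlgHom_apply hf.hasSubst, map_neg] at this
        rw [← substAlgHom_apply hf.hasSubst, ← sub_eq_zero, sub_sub_eq_add_sub, add_comm,
          add_sub_assoc, this, add_neg_cancel]
      rw [h₃, map_sub]
      obtain hm | hm : m.degree < d ∨ m.degree = d := by omega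
      · rw [mem_orderIdeal.1 hφ m hm, mem_orderIdeal.1 (subst_mem_orderIdeal hf hδd) m hm, sub_zero]
      · rw [coeff_subst_of_mem_orderIdeal hf hfc hδd hm, hδ, if_pos hm, mul_inv_cancel_left₀
          (pow_ne_zero _ h), sub_self])
  rw [sub_zero] at h₁
  refine ⟨fun _ => φ, fun _ => mem_orderIdeal_one.1 h₁, ?_⟩
  funext i
  obtain rfl := Subsingleton.elim i 0
  exact sub_eq_zero.1 h₂

/-- The inverse function theorem for power series in one variable. -/
theorem exists_inverse_of_fin_one {f : Fin 1 → MvPowerSeries (Fin 1) k} (hf : Pointed f)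
    (h : coeff (Finsupp.single 0 1) (f 0) ≠ 0) :
    ∃ g : Fin 1 → MvPowerSeries (Fin 1) k, Pointed g ∧ comp g f = var k id ∧
      comp f g = var k id := by
  obtain ⟨g, hg, hgf⟩ := exists_comp_eq_var_of_fin_one hf h
  have h₁ : coeff (Finsupp.single 0 1) (g 0) ≠ 0 := by
    intro h₀
    have := congrArg (coeff (Finsupp.single 0 1)) (congrFun hgf 0)
    rw [comp, coeff_single_subst hf (hg 0)] at this
    simp [h₀, var] at this
  obtain ⟨f', hf', hfg⟩ := exists_comp_eq_var_of_fin_one hg h₁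
  -- A left inverse and a right inverse of `g` coincide: `f' = f'(g(f)) = f`.
  have : f' = f := by
    rw [← comp_var_id f', ← hgf, ← comp_assoc _ hg hf, hfg, var_comp _ hf]; rfl
  exact ⟨g, hg, hgf, this ▸ hfg⟩

end PowerSeriesTuple

/-! ### Base change and multiplication by an integer. -/

section BaseChange

open MvPowerSeries

variable {R : Type u} {S : Type v} [CommRing R] [CommRing S] (ρ : R →+* S) {m n τ : Type}

/-- Apply a ring homomorphism to the coefficients of a tuple of power series. -/
def PowerSeriesTuple.baseChange (f : n → MvPowerSeries τ R) : n → MvPowerSeries τ S :=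
  fun i => map ρ (f i)

theorem PowerSeriesTuple.Pointed.baseChange {f : n → MvPowerSeries τ R} (hf : Pointed f) :
    Pointed (baseChange ρ f) := fun i => by
  rw [PowerSeriesTuple.baseChange, constantCoeff_map, hf i, map_zero]

theorem PowerSeriesTuple.baseChange_comp [Finite m] (f : n → MvPowerSeries m R)
    {a : m → MvPowerSeries τ R} (ha : Pointed a) :
    baseChange ρ (comp f a) = comp (baseChange ρ f) (baseChange ρ a) :=
  funext fun i => map_subst ha.hasSubst (f i)

theorem PowerSeriesTuple.baseChange_var (e : n → τ) : baseChange ρ (var R e) = var S e :=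
  funext fun i => map_X ρ (e i)

theorem PowerSeriesTuple.baseChange_zero :
    baseChange ρ (0 : n → MvPowerSeries τ R) = 0 :=
  funext fun _ => map_zero (MvPowerSeries.map ρ)

theorem PowerSeriesTuple.baseChange_elim (a : m → MvPowerSeries τ R) (b : n → MvPowerSeries τ R) :
    baseChange ρ (Sum.elim a b) = Sum.elim (baseChange ρ a) (baseChange ρ b) := by
  funext i
  cases i <;> rfl

namespace CommFormalGroup

/-- The base change of a formal group. -/
def baseChange (F : CommFormalGroup R) : CommFormalGroup S where
  dim := F.dim
  law := PowerSeriesTuple.baseChange ρ F.law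
  pointed := F.pointed.baseChange ρ
  law_zero := by
    have h := congrArg (PowerSeriesTuple.baseChange ρ) F.law_zero
    rwa [baseChange_comp ρ _ ((Pointed.var _).elim Pointed.zero), baseChange_elim,
      baseChange_var, baseChange_zero] at h
  law_assoc := by
    have h := congrArg (PowerSeriesTuple.baseChange ρ) F.law_assoc
    have hv (i : Fin 3) : Pointed (var R fun j : Fin F.dim => (i, j)) := Pointed.var _
    have hp (i j : Fin 3) := F.pointed.comp ((hv i).elim (hv j))
    rwa [baseChange_comp ρ _ ((hp 0 1).elim (hv 2)), baseChange_comp ρ _ ((hv 0).elim (hp 1 2)),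
      baseChange_elim, baseChange_elim, baseChange_comp ρ _ ((hv 0).elim (hv 1)),
      baseChange_comp ρ _ ((hv 1).elim (hv 2)), baseChange_elim, baseChange_elim,
      baseChange_var, baseChange_var, baseChange_var] at h
  law_comm := by
    have h := congrArg (PowerSeriesTuple.baseChange ρ) F.law_comm
    rwa [baseChange_comp ρ _ ((Pointed.var _).elim (Pointed.var _)), baseChange_elim,
      baseChange_var, baseChange_var] at h

/-- Multiplication by `n` on a formal group. -/
def mulNat (F : CommFormalGroup R) : ℕ → Fin F.dim → MvPowerSeries (Fin F.dim) R
  | 0 => 0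
  | n + 1 => F.add (mulNat F n) (var R id)

theorem pointed_mulNat (F : CommFormalGroup R) (n : ℕ) : Pointed (F.mulNat n) := by
  induction n with
  | zero => exact Pointed.zero
  | succ n ih => exact F.pointed_add ih (Pointed.var _)

theorem Hom.comp_mulNat {F G : CommFormalGroup R} (f : Hom F G) (n : ℕ) :
    comp f.toFun (F.mulNat n) = comp (G.mulNat n) f.toFun := by
  induction n with
  | zero =>
    rw [mulNat, mulNat, zero_comp f.pointed]
    exact funext fun i => subst_zero_of_constantCoeff_zero (f.pointed i)
  | succ n ih =>
    rw [mulNat, mulNat, f.map_add (F.pointed_mulNat n) (Pointed.var _),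
      G.add_comp (G.pointed_mulNat n) (Pointed.var _) f.pointed, ih, var_comp _ f.pointed,
      comp_var_id]
    rfl

theorem baseChange_mulNat (F : CommFormalGroup R) (n : ℕ) :
    (F.baseChange ρ).mulNat n = PowerSeriesTuple.baseChange ρ (F.mulNat n) := by
  induction n with
  | zero => exact (baseChange_zero ρ).symm
  | succ n ih =>
    have h := baseChange_comp ρ F.law ((F.pointed_mulNat n).elim (Pointed.var id))
    rw [baseChange_elim, baseChange_var] at h
    rw [mulNat, ih]
    exact h.symm

end CommFormalGroup

end BaseChange

/-! ### Lubin–Tate formal groups -/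

namespace LubinTate

open MvPowerSeries

variable (p : ℕ) [hp : Fact p.Prime] (h : ℕ) {σ τ : Type}

/-- The value at `φ` of the Lubin–Tate series `p X + X ^ (p ^ (h + 1))`. -/
def endo (φ : MvPowerSeries σ ℤ_[p]) : MvPowerSeries σ ℤ_[p] :=
  (p : ℤ_[p]) • φ + φ ^ p ^ (h + 1)

/-- `φ` commutes with the Lubin–Tate series. -/
def Commutes (φ : MvPowerSeries σ ℤ_[p]) : Prop :=
  endo p h φ = subst (fun i : σ => endo p h (X i)) φ

variable {p h}

theorem two_le_pow : 2 ≤ p ^ (h + 1) :=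
  hp.out.two_le.trans (Nat.le_self_pow (Nat.succ_ne_zero h) p)

theorem endo_subst {a : σ → MvPowerSeries τ ℤ_[p]} (ha : HasSubst a)
    (φ : MvPowerSeries σ ℤ_[p]) : subst a (endo p h φ) = endo p h (subst a φ) := by
  rw [endo, subst_add ha, subst_smul ha, subst_pow ha, endo]

theorem pointed_endo {n : Type} {a : n → MvPowerSeries τ ℤ_[p]} (ha : Pointed a) :
    Pointed fun i => endo p h (a i) := fun i => by
  have := two_le_pow (p := p) (h := h)
  simp [endo, ha i, hp.out.ne_zero]

theorem pointed_endo_X : Pointed fun i : σ => endo p h (X i : MvPowerSeries σ ℤ_[p]) :=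
  pointed_endo fun i => constantCoeff_X i

/-- The Lubin–Tate series passes first through `φ`, then through each `a i`. Thus all expressions
built from the law and the variables commute with it, which brings the group axioms within reach of
uniqueness. -/
theorem Commutes.subst [Finite σ] [Finite τ] {φ : MvPowerSeries σ ℤ_[p]} (hφ : Commutes p h φ)
    {a : σ → MvPowerSeries τ ℤ_[p]} (ha : Pointed a) (hc : ∀ i, Commutes p h (a i)) :
    Commutes p h (subst a φ) := by
  rw [Commutes, ← endo_subst ha.hasSubst, hφ,
    subst_comp_subst_apply pointed_endo_X.hasSubst ha.hasSubst,
    subst_comp_subst_apply ha.hasSubst pointed_endo_X.hasSubst]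
  congr 1
  funext i
  rw [endo_subst ha.hasSubst, subst_X ha.hasSubst]
  exact hc i

theorem commutes_X [Finite σ] (i : σ) : Commutes p h (X i : MvPowerSeries σ ℤ_[p]) := by
  rw [Commutes, subst_X pointed_endo_X.hasSubst]

theorem commutes_zero [Finite σ] : Commutes p h (0 : MvPowerSeries σ ℤ_[p]) := by
  rw [Commutes, ← substAlgHom_apply pointed_endo_X.hasSubst, map_zero]
  simp [endo, hp.out.ne_zero]

theorem endo_sub_mem (φ : MvPowerSeries σ ℤ_[p]) (hφ : constantCoeff φ = 0) :
    endo p h φ - (p : ℤ_[p]) • φ ∈ orderIdeal σ ℤ_[p] 2 := by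
  rw [endo, add_sub_cancel_left]
  exact orderIdeal_anti two_le_pow (pow_mem_orderIdeal (mem_orderIdeal_one.2 hφ) _)

theorem coeff_endo_sub_endo {φ ψ : MvPowerSeries σ ℤ_[p]} (hφ : constantCoeff φ = 0)
    (hψ : constantCoeff ψ = 0) {d : ℕ} (hd₁ : 1 ≤ d) (hd : φ - ψ ∈ orderIdeal σ ℤ_[p] d)
    {e : σ →₀ ℕ} (he : e.degree = d) :
    coeff e (endo p h φ - endo p h ψ) = p * coeff e (φ - ψ) := by
  obtain ⟨d, rfl⟩ := Nat.exists_eq_add_of_le' hd₁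
  have h₁ := pow_sub_pow_mem_orderIdeal (mem_orderIdeal_one.2 hφ) (mem_orderIdeal_one.2 hψ) hd
    (p ^ (h + 1))
  have h₂ := mem_orderIdeal.1 h₁ e (by have := two_le_pow (p := p) (h := h); omega)
  rw [endo, endo, add_sub_add_comm, ← smul_sub, map_add, h₂, add_zero, map_smul, smul_eq_mul]

theorem coeff_subst_endo [Finite σ] {d : ℕ} {φ : MvPowerSeries σ ℤ_[p]}
    (hφ : φ ∈ orderIdeal σ ℤ_[p] d) {e : σ →₀ ℕ} (he : e.degree = d) :
    coeff e (subst (fun i : σ => endo p h (X i)) φ) = (p : ℤ_[p]) ^ d * coeff e φ :=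
  coeff_subst_of_mem_orderIdeal pointed_endo_X
    (fun i => endo_sub_mem (X i) (constantCoeff_X i)) hφ he

theorem isUnit_one_sub_pow {n : ℕ} (hn : n ≠ 0) : IsUnit (1 - (p : ℤ_[p]) ^ n) :=
  IsLocalRing.isUnit_one_sub_self_of_mem_nonunits _ fun hu =>
    PadicInt.p_nonunit ((isUnit_pow_iff hn).1 hu)

/-- If the difference has order at least `d ≥ 2`, its degree-`d` form `δ` satisfies `p δ = p ^ d δ`.
As `p` is not a zero divisor and `1 - p ^ (d - 1)` is a unit, `δ` vanishes. -/
theorem Commutes.eq [Finite σ] {φ ψ : MvPowerSeries σ ℤ_[p]} (hφ : Commutes p h φ)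
    (hψ : Commutes p h ψ) (hφ₀ : constantCoeff φ = 0) (hψ₀ : constantCoeff ψ = 0)
    (hφψ : φ - ψ ∈ orderIdeal σ ℤ_[p] 2) : φ = ψ := by
  have key (d : ℕ) : φ - ψ ∈ orderIdeal σ ℤ_[p] (d + 2) := by
    induction d with
    | zero => exact hφψ
    | succ d ih =>
      refine mem_orderIdeal.2 fun e he => ?_
      obtain he | he : e.degree < d + 2 ∨ e.degree = d + 2 := by omega
      · exact mem_orderIdeal.1 ih e he
      · have h₁ := coeff_endo_sub_endo (h := h) hφ₀ hψ₀ (by omega) ih he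
        rw [hφ, hψ, ← subst_sub pointed_endo_X.hasSubst, coeff_subst_endo ih he] at h₁
        have h₂ : (p : ℤ_[p]) * ((1 - (p : ℤ_[p]) ^ (d + 1)) * coeff e (φ - ψ)) = 0 := by
          rw [← sub_eq_zero] at h₁
          linear_combination -h₁
        rw [mul_eq_zero, or_iff_right PadicInt.prime_p.ne_zero,
          (isUnit_one_sub_pow (Nat.succ_ne_zero d)).mul_right_eq_zero] at h₂
        exact h₂
  ext e
  rw [← sub_eq_zero, ← map_sub]
  exact mem_orderIdeal.1 (key e.degree) e (by omega)

/-- Modulo `p` the Lubin–Tate series is the power map of exponent `q = p ^ (h + 1)`, and Frobenius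
fixes `ZMod p`, so `φ(X) ^ q = φ(X ^ q)` there. -/
theorem dvd_coeff_endo_sub_subst [Finite σ] (φ : MvPowerSeries σ ℤ_[p]) (e : σ →₀ ℕ) :
    (p : ℤ_[p]) ∣ coeff e (endo p h φ - subst (fun i : σ => endo p h (X i)) φ) := by
  rw [← Ideal.mem_span_singleton, ← PadicInt.maximalIdeal_eq_span_p, ← PadicInt.ker_toZMod,
    RingHom.mem_ker, ← coeff_map]
  have hm (n : Type) (ψ : MvPowerSeries n ℤ_[p]) : map (PadicInt.toZMod (p := p)) (endo p h ψ) =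
      map (PadicInt.toZMod (p := p)) ψ ^ p ^ (h + 1) := by
    rw [endo, smul_eq_C_mul, map_add, map_mul, map_C, map_natCast, CharP.cast_eq_zero, map_zero,
      zero_mul, zero_add, map_pow]
  have hf : iterateFrobenius (ZMod p) p (h + 1) = RingHom.id _ := by
    ext x
    rw [iterateFrobenius_def, RingHom.id_apply, ZMod.pow_card_pow]
  have := map_iterateFrobenius_expand p hp.out.ne_zero (map (PadicInt.toZMod (p := p)) φ) (h + 1)
  rw [hf, map_id, RingHom.id_apply, expand, substAlgHom_apply] at this
  rw [map_sub, hm, map_subst pointed_endo_X.hasSubst, ← this]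
  simp_rw [hm, map_X]
  change coeff e (_ - _) = 0
  rw [sub_eq_zero.2, map_zero]
  rfl

theorem exists_commutes [Finite σ] {φ₀ : MvPowerSeries σ ℤ_[p]} (hφ₀ : constantCoeff φ₀ = 0) :
    ∃ φ, φ - φ₀ ∈ orderIdeal σ ℤ_[p] 2 ∧ Commutes p h φ := by
  let E (φ : MvPowerSeries σ ℤ_[p]) := endo p h φ - subst (fun i : σ => endo p h (X i)) φ
  have hE (φ ψ : MvPowerSeries σ ℤ_[p]) : E φ - E ψ = endo p h φ - endo p h ψ -
      subst (fun i : σ => endo p h (X i)) (φ - ψ) := by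
    simp only [E, subst_sub pointed_endo_X.hasSubst]; ring
  have hEd (d : ℕ) (φ ψ : MvPowerSeries σ ℤ_[p]) (hd : φ - ψ ∈ orderIdeal σ ℤ_[p] d) :
      E φ - E ψ ∈ orderIdeal σ ℤ_[p] d := by
    rw [hE]
    refine sub_mem ?_ (subst_mem_orderIdeal pointed_endo_X hd)
    rw [endo, endo, add_sub_add_comm, ← smul_sub, smul_eq_C_mul]
    exact add_mem (Ideal.mul_mem_left _ _ hd)
      (Ideal.mem_of_dvd _ (sub_dvd_pow_sub_pow _ _ _) hd)
  obtain ⟨φ, h₁, h₂⟩ := exists_eq_zero_of_forall_exists E hEd (d₀ := 2) (φ₀ := φ₀)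
    -- In degree one both sides are `p` times the linear part of `φ₀`, so the error starts in degree
    -- two whatever `φ₀` is.
    (by
      have h₀ := mem_orderIdeal_one.2 hφ₀
      refine mem_orderIdeal.2 fun e he => ?_
      have h₁ := mem_orderIdeal.1 (endo_sub_mem (h := h) φ₀ hφ₀) e he
      rw [map_sub, map_smul, sub_eq_zero, smul_eq_mul] at h₁
      obtain he | he : e.degree < 1 ∨ e.degree = 1 := by omega
      · rw [map_sub, h₁, mem_orderIdeal.1 h₀ e he,
          mem_orderIdeal.1 (subst_mem_orderIdeal pointed_endo_X h₀) e he, mul_zero, sub_zero]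
      · rw [map_sub, h₁, coeff_subst_endo h₀ he, pow_one, sub_self])
    (fun d hd φ hφ hEφ => by
      choose U hU using dvd_coeff_endo_sub_subst (h := h) φ
      choose V hV using fun d : ℕ =>
        (isUnit_one_sub_pow (p := p) (show d + 1 ≠ 0 by omega)).exists_right_inv
      -- The error in degree `d` is `p U`, and adding `δ` changes it by `(p - p ^ d) δ = p (1 - p ^
      -- (d - 1)) δ`; `V (d - 2)` inverts `1 - p ^ (d - 1)`.
      let δ : MvPowerSeries σ ℤ_[p] := fun m => if m.degree = d then - (V (d - 2) * U m) else 0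
      have hδ (m) : coeff m δ = if m.degree = d then - (V (d - 2) * U m) else 0 := rfl
      have hδd : δ ∈ orderIdeal σ ℤ_[p] d := mem_orderIdeal.2 fun m hm => by
        rw [hδ, if_neg hm.ne]
      have hφ' : φ ∈ orderIdeal σ ℤ_[p] 1 := by
        have := add_mem (orderIdeal_anti one_le_two hφ) (mem_orderIdeal_one.2 hφ₀)
        rwa [sub_add_cancel] at this
      have hφδ := add_mem hφ' (orderIdeal_anti (by omega : 1 ≤ d) hδd)
      refine ⟨φ + δ, by simpa using hδd, ?_⟩
      have hδ' : φ + δ - φ ∈ orderIdeal σ ℤ_[p] d := by simpa using hδd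
      refine mem_orderIdeal.2 fun m hm => ?_
      rw [← sub_add_cancel (E (φ + δ)) (E φ)]
      obtain hm | hm : m.degree < d ∨ m.degree = d := by omega
      · exact mem_orderIdeal.1 (add_mem (hEd _ _ _ hδ') hEφ) m hm
      · obtain ⟨d, rfl⟩ := Nat.exists_eq_add_of_le' hd
        rw [hE, map_add, map_sub, coeff_endo_sub_endo (mem_orderIdeal_one.1 hφδ)
          (mem_orderIdeal_one.1 hφ') (by omega) hδ' hm, coeff_subst_endo hδ' hm, hU,
          add_sub_cancel_left, hδ, if_pos hm, Nat.add_sub_cancel]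
        linear_combination -(p : ℤ_[p]) * U m * (hV d))
  exact ⟨φ, h₁, sub_eq_zero.1 h₂⟩

variable (p h)

theorem exists_law : ∃ φ : MvPowerSeries (Fin 1 ⊕ Fin 1) ℤ_[p],
    φ - (X (Sum.inl 0) + X (Sum.inr 0)) ∈ orderIdeal _ ℤ_[p] 2 ∧ Commutes p h φ :=
  exists_commutes (by simp)

/-- The Lubin–Tate formal group law. -/
def law : MvPowerSeries (Fin 1 ⊕ Fin 1) ℤ_[p] := (exists_law p h).choose

theorem law_sub_mem : law p h - (X (Sum.inl 0) + X (Sum.inr 0)) ∈ orderIdeal _ ℤ_[p] 2 :=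
  (exists_law p h).choose_spec.1

theorem commutes_law : Commutes p h (law p h) := (exists_law p h).choose_spec.2

theorem pointed_law : Pointed fun _ : Fin 1 => law p h := fun _ => by
  have := add_mem (orderIdeal_anti one_le_two (law_sub_mem p h))
    (mem_orderIdeal_one.2 (by simp : constantCoeff
      (X (Sum.inl 0) + X (Sum.inr 0) : MvPowerSeries (Fin 1 ⊕ Fin 1) ℤ_[p]) = 0))
  rw [sub_add_cancel] at this
  exact mem_orderIdeal_one.1 this

variable {a b : Fin 1 → MvPowerSeries τ ℤ_[p]}

theorem subst_law_sub_mem (ha : Pointed a) (hb : Pointed b) :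
    subst (Sum.elim a b) (law p h) - (a 0 + b 0) ∈ orderIdeal τ ℤ_[p] 2 := by
  have hab := (ha.elim hb).hasSubst
  have := subst_mem_orderIdeal (ha.elim hb) (law_sub_mem p h)
  rwa [subst_sub hab, subst_add hab, subst_X hab, subst_X hab] at this

theorem commutes_subst_law [Finite τ] (ha : Pointed a) (hb : Pointed b)
    (hca : ∀ i, Commutes p h (a i)) (hcb : ∀ i, Commutes p h (b i)) :
    Commutes p h (subst (Sum.elim a b) (law p h)) :=
  (commutes_law p h).subst (ha.elim hb) (by rintro (i | i); exacts [hca i, hcb i])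

/-- The form of uniqueness used for the group axioms and for multiplication by `p`: only linear
terms remain to be compared. -/
theorem eq_of_commutes [Finite τ] {a b : Fin 1 → MvPowerSeries τ ℤ_[p]} (ha : Pointed a)
    (hb : Pointed b) (hca : ∀ i, Commutes p h (a i)) (hcb : ∀ i, Commutes p h (b i))
    (hab : a 0 - b 0 ∈ orderIdeal τ ℤ_[p] 2) : a = b := by
  funext i
  obtain rfl := Subsingleton.elim i 0
  exact (hca 0).eq (hcb 0) (ha 0) (hb 0) hab

/-- The one-dimensional Lubin–Tate formal group over `ℤ_[p]` with endomorphism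
`p X + X ^ (p ^ (h + 1))`. -/
def formalGroup : CommFormalGroup ℤ_[p] where
  dim := 1
  law := fun _ => law p h
  pointed := pointed_law p h
  law_zero := by
    have hv : Pointed (var ℤ_[p] (id : Fin 1 → Fin 1)) := Pointed.var _
    refine eq_of_commutes p h ((pointed_law p h).comp (hv.elim Pointed.zero)) hv
      (fun i => commutes_subst_law p h hv Pointed.zero (fun i => commutes_X i)
        fun i => commutes_zero) (fun i => commutes_X i) ?_
    have h₁ := subst_law_sub_mem p h hv Pointed.zero
    rwa [Pi.zero_apply, _root_.add_zero] at h₁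
  law_assoc := by
    have hv (i : Fin 3) : Pointed (var ℤ_[p] fun j : Fin 1 => (i, j)) := Pointed.var _
    have hc (i : Fin 3) (j : Fin 1) :
        Commutes p h (var ℤ_[p] (fun j : Fin 1 => (i, j)) j) := commutes_X _
    have hp (i j : Fin 3) := (pointed_law p h).comp ((hv i).elim (hv j))
    have hcp (i j : Fin 3) := commutes_subst_law p h (hv i) (hv j) (hc i) (hc j)
    refine eq_of_commutes p h ((pointed_law p h).comp ((hp 0 1).elim (hv 2)))
      ((pointed_law p h).comp ((hv 0).elim (hp 1 2)))
      (fun i => commutes_subst_law p h (hp 0 1) (hv 2) (fun _ => hcp 0 1) (hc 2))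
      (fun i => commutes_subst_law p h (hv 0) (hp 1 2) (hc 0) (fun _ => hcp 1 2)) ?_
    have h₁ := subst_law_sub_mem p h (hp 0 1) (hv 2)
    have h₂ := subst_law_sub_mem p h (hv 0) (hp 1 2)
    have h₃ := subst_law_sub_mem p h (hv 0) (hv 1)
    have h₄ := subst_law_sub_mem p h (hv 1) (hv 2)
    -- Outer and inner congruences add up to show that both bracketings have linear part the sum of
    -- the three variables.
    convert sub_mem (add_mem h₁ h₃) (add_mem h₂ h₄) using 1
    simp only [comp]
    ring
  law_comm := by
    have hl : Pointed (var ℤ_[p] (Sum.inl : Fin 1 → Fin 1 ⊕ Fin 1)) := Pointed.var _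
    have hr : Pointed (var ℤ_[p] (Sum.inr : Fin 1 → Fin 1 ⊕ Fin 1)) := Pointed.var _
    refine eq_of_commutes p h ((pointed_law p h).comp (hr.elim hl)) (pointed_law p h)
      (fun i => commutes_subst_law p h hr hl (fun i => commutes_X _) fun i => commutes_X _)
      (fun i => commutes_law p h) ?_
    convert sub_mem (subst_law_sub_mem p h hr hl) (law_sub_mem p h) using 1
    simp only [comp, var]
    ring

theorem commutes_mulNat (n : ℕ) (i : Fin 1) : Commutes p h ((formalGroup p h).mulNat n i) := by
  induction n generalizing i with
  | zero => exact commutes_zero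
  | succ n ih =>
    exact commutes_subst_law p h ((formalGroup p h).pointed_mulNat n)
      (Pointed.var (id : Fin 1 → Fin 1)) ih fun i => commutes_X i

/-- Multiplication by `n` on the Lubin–Tate formal group. -/
def mulNat (n : ℕ) : Fin 1 → MvPowerSeries (Fin 1) ℤ_[p] := (formalGroup p h).mulNat n

theorem mulNat_sub_mem (n : ℕ) :
    mulNat p h n 0 - (n : ℤ_[p]) • (X 0 : MvPowerSeries (Fin 1) ℤ_[p]) ∈
      orderIdeal (Fin 1) ℤ_[p] 2 := by
  induction n with
  | zero =>
    rw [Nat.cast_zero, zero_smul, sub_zero]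
    exact zero_mem _
  | succ n ih =>
    have hn := add_mem (subst_law_sub_mem p h (a := mulNat p h n)
      ((formalGroup p h).pointed_mulNat n) (Pointed.var (id : Fin 1 → Fin 1))) ih
    have e (x y z w : MvPowerSeries (Fin 1) ℤ_[p]) : x - (y + z) + (y - w) = x - (w + z) := by ring
    rw [e] at hn
    rw [Nat.cast_succ, add_smul, one_smul]
    exact hn

theorem commutes_endo_X (i : σ) [Finite σ] : Commutes p h (endo p h (X i)) := by
  rw [Commutes, endo_subst pointed_endo_X.hasSubst, subst_X pointed_endo_X.hasSubst]

/-- Both series commute with the Lubin–Tate series and have linear term `p X`, so uniqueness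
identifies them. -/
theorem mulNat_prime :
    mulNat p h p = fun i : Fin 1 => endo p h (X i) := by
  refine eq_of_commutes p h ((formalGroup p h).pointed_mulNat p) pointed_endo_X
    (commutes_mulNat p h p) (fun i => commutes_endo_X p h i) ?_
  have h₁ := sub_mem (mulNat_sub_mem p h p) (endo_sub_mem (h := h) (X 0) (constantCoeff_X 0))
  rwa [sub_sub_sub_cancel_right] at h₁

variable {k : Type u} [Field k] [CharP k p]

/-- The reduction of a Lubin–Tate formal group to a field of characteristic `p`; it has height
`h + 1`. -/
def reduction (k : Type u) [Field k] [CharP k p] : CommFormalGroup k :=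
  (formalGroup p h).baseChange ((ZMod.castHom dvd_rfl k).comp (PadicInt.toZMod (p := p)))

theorem reduction_mulNat_prime :
    (reduction p h k).mulNat p = fun i : Fin 1 => X i ^ p ^ (h + 1) := by
  refine (CommFormalGroup.baseChange_mulNat _ _ p).trans
    ((congrArg (PowerSeriesTuple.baseChange _) (mulNat_prime p h)).trans (funext fun i => ?_))
  rw [PowerSeriesTuple.baseChange, endo, smul_eq_C_mul, map_add, map_mul, map_C, map_natCast,
    CharP.cast_eq_zero, map_zero, zero_mul, zero_add, map_pow, map_X]

/-- Commuting with multiplication by `p` gives `u(X ^ (p ^ (h + 1))) = u(X) ^ (p ^ (h' + 1))`. The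
left side has the nonzero linear coefficient of `u` in degree `p ^ (h + 1)`, while the right side
has order at least `p ^ (h' + 1)`. -/
theorem le_of_hom {h h' : ℕ} (f : reduction p h k ⟶ reduction p h' k)
    (hf : coeff (Finsupp.single (0 : Fin 1) 1)
      (f.toFun (0 : Fin 1)) ≠ 0) : h' ≤ h := by
  by_contra! hlt
  let u : Fin 1 → MvPowerSeries (Fin 1) k := f.toFun
  have hu : Pointed u := f.pointed
  have hX (h : ℕ) : HasSubst fun i : Fin 1 => (X i : MvPowerSeries (Fin 1) k) ^ p ^ (h + 1) :=
    HasSubst.X_pow (pow_ne_zero _ hp.out.ne_zero)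
  have h₁ : comp u (fun i : Fin 1 => X i ^ p ^ (h + 1)) =
      comp (fun i : Fin 1 => X i ^ p ^ (h' + 1)) u := by
    have := f.comp_mulNat p
    rwa [reduction_mulNat_prime, reduction_mulNat_prime] at this
  have h₂ := congrFun h₁ 0
  rw [comp, comp, subst_pow hu.hasSubst, subst_X hu.hasSubst, ← substAlgHom_apply (hX h)] at h₂
  have h₃ := coeff_expand_smul (p ^ (h + 1)) (pow_ne_zero _ hp.out.ne_zero) (u 0)
    (Finsupp.single 0 1)
  rw [expand, h₂] at h₃
  rw [mem_orderIdeal.1 (pow_mem_orderIdeal (mem_orderIdeal_one.2 (hu 0)) _)] at h₃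
  · exact hf h₃.symm
  · simpa using Nat.pow_lt_pow_right hp.out.one_lt (by omega)

end LubinTate

namespace CommFormalGroup

open MvPowerSeries

variable {k : Type u} [Field k] {F G H : CommFormalGroup k}

/-! ### The Jacobian at the origin -/

/-- The Jacobian matrix of a homomorphism at the origin. -/
def jacobian (f : F ⟶ G) : Matrix (Fin G.dim) (Fin F.dim) k :=
  Matrix.of fun i j => coeff (Finsupp.single j 1) (f.toFun i)

theorem jacobian_comp (f : F ⟶ G) (g : G ⟶ H) : jacobian (f ≫ g) = jacobian g * jacobian f := by
  ext i j
  exact coeff_single_subst f.pointed (g.pointed i) j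

theorem jacobian_id : jacobian (𝟙 F) = 1 := by
  classical
  ext i j
  change coeff (Finsupp.single j 1) (X i) = _
  simp [coeff_X, Matrix.one_apply, Finsupp.single_left_inj, eq_comm]

theorem zero_add_zero {τ : Type} : G.add (0 : Fin G.dim → MvPowerSeries τ k) 0 = 0 :=
  G.add_zero Pointed.zero

/-- The zero homomorphism. -/
def zeroHom (F G : CommFormalGroup k) : F ⟶ G :=
  Hom.mk' 0 Pointed.zero fun a b ha hb => by
    rw [zero_comp ha, zero_comp hb, zero_comp (F.pointed_add ha hb), zero_add_zero]

theorem jacobian_zeroHom : jacobian (zeroHom F G) = 0 := by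
  ext i j
  exact map_zero (coeff (Finsupp.single j 1))

theorem dim_eq_of_iso (e : F ≅ G) : F.dim = G.dim := by
  have h := Matrix.square_of_invertible (jacobian e.hom) (jacobian e.inv)
    (by rw [← jacobian_comp, e.inv_hom_id, jacobian_id])
    (by rw [← jacobian_comp, e.hom_inv_id, jacobian_id])
  simpa using h.symm

theorem jacobian_ne_zero (e : F ≅ G) (hG : G.dim = 1) (i : Fin G.dim) (j : Fin F.dim) :
    jacobian e.hom i j ≠ 0 := fun h => by
  have : Subsingleton (Fin G.dim) := by rw [hG]; infer_instance
  have h₁ := congrFun (congrFun (jacobian_comp e.hom e.inv) j) j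
  rw [e.hom_inv_id, jacobian_id, Matrix.one_apply_eq, Matrix.mul_apply] at h₁
  refine one_ne_zero (h₁.trans (Finset.sum_eq_zero fun i' _ => ?_))
  rw [Subsingleton.elim i' i, h, mul_zero]

/-- An inverse tuple is automatically additive: write the arguments as values of `f`, use additivity
of `f`, then cancel `g` against `f`. -/
theorem isIso_of_inverse (f : F ⟶ G) {g : Fin F.dim → MvPowerSeries (Fin G.dim) k}
    (hg : Pointed g) (hgf : comp g f.toFun = var k id) (hfg : comp f.toFun g = var k id) :
    IsIso f := by
  let g' : G ⟶ F := Hom.mk' g hg fun a b ha hb => by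
    have hid {c : Fin G.dim → MvPowerSeries (Fin G.dim ⊕ Fin G.dim) k} (hc : Pointed c) :
        comp f.toFun (comp g c) = c := by
      rw [← comp_assoc _ hg hc, hfg, var_comp _ hc]; rfl
    have hga := hg.comp ha
    have hgb := hg.comp hb
    rw [← hid ha, ← hid hb, ← f.map_add hga hgb, hid ha, hid hb,
      ← comp_assoc _ f.pointed (F.pointed_add hga hgb), hgf, var_comp _ (F.pointed_add hga hgb)]
    rfl
  exact ⟨g', hom_ext hgf, hom_ext hfg⟩

/-- The dimensions are free variables here so that the equations can be substituted; `F.dim = 1`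
itself cannot be. -/
theorem exists_inverse {m n : ℕ} (hm : m = 1) (hn : n = 1) {f : Fin m → MvPowerSeries (Fin n) k}
    (hf : Pointed f) (i : Fin m) (j : Fin n) (h : coeff (Finsupp.single j 1) (f i) ≠ 0) :
    ∃ g : Fin n → MvPowerSeries (Fin m) k, Pointed g ∧ comp g f = var k id ∧
      comp f g = var k id := by
  subst hm hn
  obtain rfl := Subsingleton.elim i 0
  obtain rfl := Subsingleton.elim j 0
  exact exists_inverse_of_fin_one hf h

theorem isIso_of_jacobian_ne_zero (hF : F.dim = 1) (hG : G.dim = 1) (f : F ⟶ G) (i : Fin G.dim)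
    (j : Fin F.dim) (h : jacobian f i j ≠ 0) : IsIso f := by
  obtain ⟨g, hg, h₁, h₂⟩ := exists_inverse hG hF f.pointed i j h
  exact isIso_of_inverse f hg h₁ h₂

end CommFormalGroup

/-! ### Products as universal families -/

namespace CategoryTheory

variable {C : Type u} [Category.{v} C] {ι κ : Type}

/-- The family `π` exhibits `X` as the product of the family `G`. -/
def IsProductOf {X : C} {G : ι → C} (π : ∀ i, X ⟶ G i) : Prop :=
  ∀ Z : C, Function.Bijective fun (f : Z ⟶ X) i => f ≫ π i

theorem isProductOf_iff {X : C} {G : ι → C} (π : ∀ i, X ⟶ G i) :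
    IsProductOf π ↔ Nonempty (IsLimit (Fan.mk X π)) := by
  refine ⟨fun h => ?_, fun ⟨h⟩ Z => ⟨fun f g hfg => ?_, fun f => ?_⟩⟩
  · choose l hl using fun Z => (h Z).2
    exact ⟨Fan.IsLimit.mk _ (fun s => l s.pt s.proj) (fun s j => congrFun (hl s.pt s.proj) j)
      fun s m hm => (h s.pt).1 ((funext hm).trans (hl s.pt s.proj).symm)⟩
  · exact h.hom_ext fun ⟨j⟩ => congrFun hfg j
  · exact ⟨Fan.IsLimit.lift h f, funext fun j => Fan.IsLimit.fac h f j⟩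

theorem IsProductOf.reindex {X : C} {G : ι → C} {π : ∀ i, X ⟶ G i} (h : IsProductOf π)
    (e : κ ≃ ι) : IsProductOf fun j => π (e j) := fun Z =>
  (Equiv.piCongrLeft (fun i => Z ⟶ G i) e).symm.bijective.comp (h Z)

theorem IsProductOf.nonempty_iso {X Y : C} {G : ι → C} {π : ∀ i, X ⟶ G i} {ρ : ∀ i, Y ⟶ G i}
    (h : IsProductOf π) (h' : IsProductOf ρ) : Nonempty (X ≅ Y) := by
  obtain ⟨l⟩ := (isProductOf_iff π).1 h
  obtain ⟨l'⟩ := (isProductOf_iff ρ).1 h'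
  exact ⟨l.conePointUniqueUpToIso l'⟩

end CategoryTheory

/-! ### Uniqueness of decompositions -/

namespace CommFormalGroup

variable {k : Type u} [Field k] {ι κ : Type}

/-- The universal property is applied to the identity on one factor and zero on the others;
`eqToHom` carries the identity along `i = j`. -/
theorem exists_sections [DecidableEq ι] {X : CommFormalGroup k} {G : ι → CommFormalGroup k}
    {π : ∀ i, X ⟶ G i} (hπ : IsProductOf π) : ∃ s : ∀ i, G i ⟶ X,
      (∀ i, s i ≫ π i = 𝟙 _) ∧ ∀ i j, i ≠ j → s i ≫ π j = zeroHom _ _ := by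
  choose s hs using fun i => (hπ (G i)).2 fun j =>
    if h : i = j then eqToHom (congrArg G h) else zeroHom (G i) (G j)
  refine ⟨s, fun i => ?_, fun i j hij => ?_⟩
  · simpa using congrFun (hs i) i
  · simpa [hij] using congrFun (hs i) j

theorem exists_jacobian_sections [DecidableEq ι] [Fintype ι] {X : CommFormalGroup k}
    {G : ι → CommFormalGroup k} (z : ∀ i, Fin (G i).dim) {π : ∀ i, X ⟶ G i}
    (hπ : IsProductOf π) : ∃ s : ∀ i, G i ⟶ X,
      (Matrix.of fun i a => jacobian (π i) (z i) a) *
        (Matrix.of fun a i => jacobian (s i) a (z i)) = 1 := by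
  obtain ⟨s, h₁, h₂⟩ := exists_sections hπ
  refine ⟨s, ?_⟩
  ext i j
  have h : _ = (jacobian (π i) * jacobian (s j)) (z i) (z j) := Matrix.mul_apply.symm
  refine h.trans ?_
  rw [← jacobian_comp]
  obtain rfl | hij := eq_or_ne j i
  · rw [h₁, jacobian_id, Matrix.one_apply_eq, Matrix.one_apply_eq]
  · rw [h₂ j i hij, jacobian_zeroHom, Matrix.one_apply_ne hij.symm, Matrix.zero_apply]

/-- Two decompositions of a formal group into one-dimensional factors agree up to permutation and
isomorphism. -/
theorem exists_equiv_of_iso {n m : ℕ} {X Y : CommFormalGroup k}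
    {G : Fin n → CommFormalGroup k} {H : Fin m → CommFormalGroup k}
    (hG : ∀ i, (G i).dim = 1) (hH : ∀ i, (H i).dim = 1) {π : ∀ i, X ⟶ G i} {ρ : ∀ i, Y ⟶ H i}
    (hπ : IsProductOf π) (hρ : IsProductOf ρ) (hX : X.dim = n) (hY : Y.dim = m) (e : X ≅ Y) :
    ∃ σ : Fin n ≃ Fin m, ∀ i, Nonempty (G i ≅ H (σ i)) := by
  obtain rfl : n = m := by rw [← hX, ← hY, dim_eq_of_iso e]
  let z (i : Fin n) : Fin (G i).dim := ⟨0, by rw [hG]; exact Nat.one_pos⟩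
  let w (i : Fin n) : Fin (H i).dim := ⟨0, by rw [hH]; exact Nat.one_pos⟩
  obtain ⟨s, hs⟩ := exists_jacobian_sections z hπ
  obtain ⟨t, ht⟩ := exists_jacobian_sections w hρ
  set T : Matrix (Fin n) (Fin X.dim) k := Matrix.of fun i a => jacobian (π i) (z i) a
  set S : Matrix (Fin X.dim) (Fin n) k := Matrix.of fun a i => jacobian (s i) a (z i) with hS
  set P : Matrix (Fin n) (Fin Y.dim) k := Matrix.of fun i a => jacobian (ρ i) (w i) a with hP
  set Q : Matrix (Fin Y.dim) (Fin n) k := Matrix.of fun a i => jacobian (t i) a (w i)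
  let M : Matrix (Fin n) (Fin n) k := P * (jacobian e.hom * S)
  -- Since `X.dim = n`, the matrices are square in size, so the one-sided inverse provided by the
  -- sections is two-sided.
  have hST : S * T = 1 := (Matrix.mul_eq_one_comm_of_card_eq _ _ _
    (by rw [Fintype.card_fin, Fintype.card_fin, hX])).1 hs
  have hM : M * (T * (jacobian e.inv * Q)) = 1 := by
    have h₁ : M * (T * (jacobian e.inv * Q)) =
        P * (jacobian e.hom * ((S * T) * jacobian e.inv)) * Q := by
      simp only [M, Matrix.mul_assoc]
    rw [h₁, hST, Matrix.one_mul, ← jacobian_comp, e.inv_hom_id, jacobian_id, Matrix.mul_one, ht]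
  have hdet : M.det ≠ 0 := fun h₀ => by
    have := congrArg Matrix.det hM
    simp [h₀] at this
  -- A nonzero determinant has a nonzero Leibniz term; all factors `M (σ i) i` of that term are
  -- nonzero.
  rw [Matrix.det_apply] at hdet
  obtain ⟨σ, -, hσ⟩ := Finset.exists_ne_zero_of_sum_ne_zero hdet
  refine ⟨σ, fun i => ?_⟩
  have hi : M (σ i) i ≠ 0 := fun h₀ => hσ (by
    rw [show ∏ i, M (σ i) i = 0 from Finset.prod_eq_zero (Finset.mem_univ i) h₀, smul_zero])
  -- By the chain rule, the entry is the Jacobian of a homomorphism `G i ⟶ H (σ i)`, which is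
  -- therefore an isomorphism.
  have hMi : M (σ i) i = jacobian (s i ≫ e.hom ≫ ρ (σ i)) (w (σ i)) (z i) := by
    rw [jacobian_comp, jacobian_comp, Matrix.mul_assoc]
    simp only [M, Matrix.mul_apply, hS, hP, Matrix.of_apply]
  rw [hMi] at hi
  have := isIso_of_jacobian_ne_zero (hG i) (hH _) _ _ _ hi
  exact ⟨asIso (s i ≫ e.hom ≫ ρ (σ i))⟩

theorem isProductOfOneDim_of_isProductOf [Finite ι] {X : CommFormalGroup k}
    {G : ι → CommFormalGroup k} (hG : ∀ i, (G i).dim = 1) {π : ∀ i, X ⟶ G i}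
    (hπ : IsProductOf π) : IsProductOfOneDim k X :=
  ⟨ι, inferInstance, G, π, hG, (isProductOf_iff π).1 hπ⟩

theorem isProductOfOneDim_of_dim_eq_one {F : CommFormalGroup k} (hF : F.dim = 1) :
    IsProductOfOneDim k F :=
  isProductOfOneDim_of_isProductOf (ι := Unit) (G := fun _ => F) (π := fun _ => 𝟙 F)
    (fun _ => hF) fun Z => ⟨fun f g h => by simpa using congrFun h (), fun f => ⟨f (), by simp⟩⟩

/-- The zero-dimensional formal group. -/
def trivial (k : Type u) [Field k] : CommFormalGroup k where
  dim := 0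
  law := Fin.elim0
  pointed := fun i => i.elim0
  law_zero := funext fun i => i.elim0
  law_assoc := funext fun i => i.elim0
  law_comm := funext fun i => i.elim0

theorem hom_trivial_ext {F : CommFormalGroup k} (f g : F ⟶ trivial k) : f = g :=
  hom_ext (funext fun i => i.elim0)

end CommFormalGroup

/-! ### Concrete products and their classes in `FG`. -/

namespace FG

open CommFormalGroup

variable {k : Type u} [Field k]

theorem of_eq_of_iso {X Y : FG k} (e : X.obj ≅ Y.obj) : IsoClass.of X = IsoClass.of Y :=
  Quotient.sound ⟨(IsProductOfOneDim k).isoMk e⟩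

theorem nonempty_iso_of_of_eq {X Y : FG k} (h : IsoClass.of X = IsoClass.of Y) :
    Nonempty (X.obj ≅ Y.obj) :=
  (Quotient.exact h).map (IsProductOfOneDim k).ι.mapIso

theorem of_trivial (h : IsProductOfOneDim k (trivial k)) :
    IsoClass.of (⟨trivial k, h⟩ : FG k) = 0 := by
  have t : IsTerminal (⟨trivial k, h⟩ : FG k) :=
    IsTerminal.ofUniqueHom (fun X => ObjectProperty.homMk (zeroHom X.obj (trivial k)))
      fun X f => ObjectProperty.hom_ext _ (hom_trivial_ext _ _)
  exact Quotient.sound ⟨t.uniqueUpToIso terminalIsTerminal⟩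

theorem of_prod {F G : CommFormalGroup k} (hF : IsProductOfOneDim k F)
    (hG : IsProductOfOneDim k G) (h : IsProductOfOneDim k (CommFormalGroup.prod F G)) :
    IsoClass.of (⟨CommFormalGroup.prod F G, h⟩ : FG k) =
      IsoClass.of ⟨F, hF⟩ + IsoClass.of ⟨G, hG⟩ := by
  let X : FG k := ⟨CommFormalGroup.prod F G, h⟩
  let f : X ⟶ ⟨F, hF⟩ := ObjectProperty.homMk (prodFst F G)
  let g : X ⟶ ⟨G, hG⟩ := ObjectProperty.homMk (prodSnd F G)
  have t : IsLimit (BinaryFan.mk f g) :=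
    isLimitOfReflectsOfMapIsLimit (IsProductOfOneDim k).ι f g (prodIsLimit F G)
  exact Quotient.sound ⟨t.conePointUniqueUpToIso (limit.isLimit _)⟩

/-- An explicit iterated product, for which the dimension and the class are known; an abstract
product is compared with it by uniqueness of products. -/
theorem exists_product (n : ℕ) (G : Fin n → CommFormalGroup k) (hG : ∀ i, (G i).dim = 1) :
    ∃ (X : FG k) (π : ∀ i, X.obj ⟶ G i), IsProductOf π ∧ X.obj.dim = n ∧
      IsoClass.of X =
        ∑ i, IsoClass.of (⟨G i, isProductOfOneDim_of_dim_eq_one (hG i)⟩ : FG k) := by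
  induction n with
  | zero =>
    let π (i : Fin 0) : trivial k ⟶ G i := i.elim0
    have hπ : IsProductOf π := fun Z =>
      ⟨fun _ _ _ => hom_trivial_ext _ _, fun f => ⟨zeroHom _ _, funext fun i => i.elim0⟩⟩
    exact ⟨⟨trivial k, isProductOfOneDim_of_isProductOf hG hπ⟩, π, hπ, rfl, by
      rw [of_trivial, Finset.univ_eq_empty, Finset.sum_empty]⟩
  | succ n ih =>
    obtain ⟨X, π, hπ, hdim, hX⟩ := ih (fun i => G i.succ) fun i => hG i.succ
    let ρ : ∀ i, CommFormalGroup.prod (G 0) X.obj ⟶ G i :=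
      Fin.cases (prodFst _ _) fun i => prodSnd _ _ ≫ π i
    have hρ : IsProductOf ρ := fun Z => by
      refine ⟨fun f g hfg => prod_hom_ext (congrFun hfg 0) ((hπ Z).1 (funext fun i => ?_)),
        fun f => ?_⟩
      · simpa [ρ] using congrFun hfg i.succ
      · obtain ⟨g, hg⟩ := (hπ Z).2 fun i => f i.succ
        refine ⟨prodLift (f 0) g, funext (Fin.cases (prodLift_fst _ _) fun i => ?_)⟩
        change prodLift (f 0) g ≫ prodSnd _ _ ≫ π i = _
        rw [← Category.assoc, prodLift_snd]
        exact congrFun hg i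
    refine ⟨⟨_, isProductOfOneDim_of_isProductOf hG hρ⟩, ρ, hρ, ?_, ?_⟩
    · change (G 0).dim + X.obj.dim = n + 1
      rw [hG, hdim, Nat.add_comm]
    · rw [of_prod (isProductOfOneDim_of_dim_eq_one (hG 0)) X.property, Fin.sum_univ_succ, ← hX]

/-! ### The monoid of isomorphism classes -/

variable (k) in
/-- One-dimensional commutative formal groups. -/
abbrev OneDim : Type u := {F : CommFormalGroup k // F.dim = 1}

instance oneDimSetoid : Setoid (OneDim k) := (isIsomorphicSetoid (CommFormalGroup k)).comap (·.1)

variable (k) in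
/-- Isomorphism classes of one-dimensional commutative formal groups. -/
abbrev OneDimClass : Type u := Quotient (oneDimSetoid (k := k))

/-- The class of a one-dimensional formal group in the monoid of isomorphism classes. -/
def ofOneDimClass : OneDimClass k → IsoClass (FG k) :=
  Quotient.lift (fun F => IsoClass.of ⟨F.1, isProductOfOneDim_of_dim_eq_one F.2⟩)
    fun _ _ ⟨e⟩ => of_eq_of_iso e

variable (k) in
/-- The sum of a multiset of isomorphism classes of one-dimensional formal groups. -/
def sumHom : Multiset (OneDimClass k) →+ IsoClass (FG k) :=
  Multiset.sumAddMonoidHom.comp (Multiset.mapAddMonoidHom ofOneDimClass)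

theorem exists_eq_sum_singleton {α : Type*} (s : Multiset α) :
    ∃ (n : ℕ) (a : Fin n → α), s = ∑ i, {a i} := by
  induction s using Multiset.induction with
  | empty => exact ⟨0, Fin.elim0, by simp⟩
  | cons b s ih =>
    obtain ⟨n, a, rfl⟩ := ih
    exact ⟨n + 1, Fin.cons b a, by simp [Fin.sum_univ_succ]⟩

theorem sumHom_sum {n : ℕ} (G : Fin n → OneDim k) :
    sumHom k (∑ i, {(⟦G i⟧ : OneDimClass k)}) =
      ∑ i, IsoClass.of (⟨(G i).1, isProductOfOneDim_of_dim_eq_one (G i).2⟩ : FG k) := by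
  rw [map_sum]
  refine Finset.sum_congr rfl fun i _ => ?_
  change (Multiset.map ofOneDimClass {(⟦G i⟧ : OneDimClass k)}).sum = _
  rw [Multiset.map_singleton, Multiset.sum_singleton]
  rfl

/-- Injectivity is the uniqueness of decompositions; surjectivity is their existence, built into the
definition of `FG`. -/
theorem sumHom_bijective : Function.Bijective (sumHom k) := by
  constructor
  · intro s t hst
    obtain ⟨n, a, rfl⟩ := exists_eq_sum_singleton s
    obtain ⟨m, b, rfl⟩ := exists_eq_sum_singleton t
    choose G hG using fun i => Quotient.exists_rep (a i)
    choose H hH using fun i => Quotient.exists_rep (b i)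
    obtain rfl : _ = a := funext hG
    obtain rfl : _ = b := funext hH
    rw [sumHom_sum, sumHom_sum] at hst
    obtain ⟨X, π, hπ, hXn, hX⟩ := exists_product n (fun i => (G i).1) fun i => (G i).2
    obtain ⟨Y, ρ, hρ, hYm, hY⟩ := exists_product m (fun i => (H i).1) fun i => (H i).2
    obtain ⟨e⟩ := nonempty_iso_of_of_eq (hX.trans (hst.trans hY.symm))
    obtain ⟨σ, hσ⟩ := exists_equiv_of_iso (fun i => (G i).2) (fun i => (H i).2) hπ hρ hXn hYm e
    refine Fintype.sum_equiv σ _ _ fun i => ?_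
    exact congrArg _ (Quotient.sound (hσ i))
  · rintro ⟨X⟩
    obtain ⟨ι, _, G, π, hG, h⟩ := X.property
    have hπ := (isProductOf_iff π).2 h
    obtain ⟨n, ⟨e⟩⟩ := Finite.exists_equiv_fin ι
    obtain ⟨Y, ρ, hρ, -, hY⟩ := exists_product n (fun i => G (e.symm i)) fun i => hG _
    refine ⟨∑ i, {(⟦⟨G (e.symm i), hG _⟩⟧ : OneDimClass k)},
      (sumHom_sum fun i => ⟨G (e.symm i), hG _⟩).trans (hY.symm.trans ?_)⟩
    obtain ⟨e'⟩ := hρ.nonempty_iso (hπ.reindex e.symm)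
    exact of_eq_of_iso e'

end FG

/-! ### The Grothendieck group of a free commutative monoid -/

/-- The inclusion of `α →₀ ℕ` in `α →₀ ℤ` extends to the completion, giving `g`; freeness of `α →₀
ℤ` gives `f`. The composites are identities because they are so on generators. -/
theorem Algebra.GrothendieckAddGroup.nonempty_basis {α : Type u} {M : Type v} [AddCommMonoid M]
    (e : (α →₀ ℕ) ≃+ M) : Nonempty (Module.Basis α ℤ (GrothendieckAddGroup M)) := by
  obtain ⟨φ, hφ⟩ : ∃ φ : M →+ GrothendieckAddGroup M, φ = of := ⟨_, rfl⟩
  let f : (α →₀ ℤ) →+ GrothendieckAddGroup M :=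
    Finsupp.liftAddHom fun a => zmultiplesHom _ (φ (e (Finsupp.single a 1)))
  let g₀ : M →+ (α →₀ ℤ) :=
    (Finsupp.mapRange.addMonoidHom (Nat.castAddMonoidHom ℤ)).comp e.symm.toAddMonoidHom
  let g := lift g₀
  have hg (x : M) : g (φ x) = g₀ x := hφ ▸ DFunLike.congr_fun (lift.symm_apply_apply g₀) x
  have hgf : g.comp f = AddMonoidHom.id _ := by
    ext a : 2
    simp [f, hg, g₀]
  have hfg : f.comp g = AddMonoidHom.id _ := by
    refine lift.symm.injective (AddMonoidHom.ext fun x => ?_)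
    rw [lift_symm_apply, lift_symm_apply, ← hφ]
    change f (g (φ x)) = φ x
    rw [hg]
    have : (f.comp g₀).comp e.toAddMonoidHom = φ.comp e.toAddMonoidHom := by
      ext a
      simp [f, g₀]
    simpa using DFunLike.congr_fun this (e.symm x)
  exact ⟨⟨(AddMonoidHom.toAddEquiv g f hfg hgf).toIntLinearEquiv⟩⟩

/-- An isomorphism and its inverse both have nonzero Jacobian, so `le_of_hom` applies in both
directions and isomorphic reductions have equal `h`. -/
theorem FG.infinite_oneDimClass (k : Type u) [Field k] (hk : ringChar k ≠ 0) :
    Infinite (FG.OneDimClass k) := by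
  have hp : Fact (ringChar k).Prime :=
    ⟨(CharP.char_is_prime_or_zero k (ringChar k)).resolve_right hk⟩
  let F (h : ℕ) : FG.OneDim k := ⟨LubinTate.reduction (ringChar k) h k, rfl⟩
  have key {h h' : ℕ} (e : (F h).1 ≅ (F h').1) : h' ≤ h :=
    LubinTate.le_of_hom (ringChar k) e.hom
      (CommFormalGroup.jacobian_ne_zero e rfl (0 : Fin 1) (0 : Fin 1))
  exact Infinite.of_injective (fun h => (⟦F h⟧ : FG.OneDimClass k)) fun h h' hh => by
    obtain ⟨e⟩ := Quotient.exact hh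
    exact le_antisymm (key e.symm) (key e)

end

theorem mainTheorem1 (k : Type u) [Field k] :
    ∃ ι : Type u, Nonempty (Module.Basis ι ℤ (K0 (FG k))) ∧ (ringChar k ≠ 0 → Infinite ι) := by
  classical
  exact ⟨FG.OneDimClass k, Algebra.GrothendieckAddGroup.nonempty_basis
    (Multiset.toFinsupp.symm.trans (AddEquiv.ofBijective (FG.sumHom k) FG.sumHom_bijective)),
    FG.infinite_oneDimClass k⟩
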